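/- Let $2\le n<\infty$, let $a_1,\dots,a_n$ be the free generators of the free group $F_n$, let $L(F_n)\subset B(\ell^2(F_n))$ be its group von Neumann algebra (generated by the left regular representation $\lambda$) with canonical trace $\tau(x)=\langle x\delta_e,\delta_e\rangle$, and let $w_i=\lambda_{a_i}$. Put $A_i=\{w_i\}''$, $B_i=\{w_i+w_i^*\}''\subset A_i$ and let $A_r=\{\sum_{i=1}^n (w_i+w_i^*)\}''$ be the radial MASA. Identify $A_i$ with $L^\infty([-1,1],dt/2)$ by the trace-preserving isomorphism sending $w_i$ to $e^{i\pi t}$; it sends $B_i$ to the even functions. For von Neumann subalgebras $B\subset A$, $E_B$ denotes the trace-preserving conditional expectation onto $B$. A unitary is called a Haar unitary if all its nonzero powers have trace $0$. An element $u$ is free from a von Neumann subalgebra $B$ if the von Neumann algebras $\{u\}''$ and $B$ are freely independent with respect to the trace. (1) For each $i$ there is exactly one element $u_i\in A_i$ corresponding to the function $|t|/t$. It is a unitary with $u_i^2=1$ and $E_{B_i}(u_i)=0$. For all $i\ne j$, the element $u_iu_j\in L(F_n)$ is a Haar unitary and is free from $A_r$. More generally, if $i\neq j$ and $u\in A_i$,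 $v\in A_j$ are any unitaries with $E_{B_i}(u)=0$ and $E_{B_j}(v)=0$, then $uv$ is a Haar unitary in $L(F_n)$ that is free from $A_r$. Hence $A_r\subset L(F_n)$ satisfies Popa's weak FC property: there is a Haar unitary in $L(F_n)$ that is free from $A_r$. (2) Let $A_1,A_2$ be abelian tracial von Neumann algebras, let $M=A_1*A_2$ be their tracial free product, let $B_i\subset A_i$ be von Neumann subalgebras, and let $u_i\in A_i$ be unitaries with $E_{B_i}(u_i)=0$ for $i=1,2$. Then $u_1u_2$ is free from $B_1*B_2=(B_1\cup B_2)''$. -/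

import Mathlib

open scoped ENNReal

/-! ### Generated von Neumann algebras, traces, freeness -/

section VonNeumann

variable {H : Type*} [NormedAddCommGroup H] [InnerProductSpace ℂ H] [CompleteSpace H]

/-- The von Neumann algebra `S''` generated by a set `S` of bounded operators:
the bicommutant of `S ∪ S*`. -/
noncomputable def vnGen (S : Set (H →L[ℂ] H)) : VonNeumannAlgebra H where
  toStarSubalgebra := StarSubalgebra.centralizer ℂ (StarSubalgebra.centralizer ℂ S : Set (H →L[ℂ] H))
  centralizer_centralizer' := by
    change Set.centralizer (Set.centralizer (StarSubalgebra.centralizer ℂ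
      (StarSubalgebra.centralizer ℂ S : Set (H →L[ℂ] H)) : Set (H →L[ℂ] H))) =
      (StarSubalgebra.centralizer ℂ
      (StarSubalgebra.centralizer ℂ S : Set (H →L[ℂ] H)) : Set (H →L[ℂ] H))
    rw [StarSubalgebra.coe_centralizer, Set.centralizer_centralizer_centralizer]

theorem coe_vnGen (S : Set (H →L[ℂ] H)) :
    (vnGen S : Set (H →L[ℂ] H)) = Set.centralizer (Set.centralizer (S ∪ star S)) := by
  change (StarSubalgebra.centralizer ℂ
      (StarSubalgebra.centralizer ℂ S : Set (H →L[ℂ] H)) : Set (H →L[ℂ] H)) = _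
  have hs : star (StarSubalgebra.centralizer ℂ S : Set (H →L[ℂ] H)) =
      (StarSubalgebra.centralizer ℂ S : Set (H →L[ℂ] H)) := by
    ext x
    exact star_mem_iff (s := StarSubalgebra.centralizer ℂ S) (x := x)
  rw [StarSubalgebra.coe_centralizer, hs, Set.union_self, StarSubalgebra.coe_centralizer]

/-- `τ` is a faithful normal tracial state on the von Neumann algebra `M ⊆ B(H)`, so that `(M, τ)`
is a tracial von Neumann algebra. Only the values of `τ` on `M` matter. Normality
(with positivity) is expressed by `τ x = ∑ₖ ⟪ξₖ, x ξₖ⟫` with `∑ₖ ‖ξₖ‖² < ∞`. -/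
structure IsTracialVNA (M : VonNeumannAlgebra H) (τ : (H →L[ℂ] H) →ₗ[ℂ] ℂ) : Prop where
  normal : ∃ ξ : ℕ → H, Summable (fun k => ‖ξ k‖ ^ 2) ∧
    ∀ x ∈ M, HasSum (fun k => inner ℂ (ξ k) (x (ξ k))) (τ x)
  unital : τ 1 = 1
  tracial : ∀ x ∈ M, ∀ y ∈ M, τ (x * y) = τ (y * x)
  faithful : ∀ x ∈ M, τ (star x * x) = 0 → x = 0

/-- The von Neumann algebra `A` is abelian. -/
def IsAbelianVNA (A : VonNeumannAlgebra H) : Prop :=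
  ∀ x ∈ A, ∀ y ∈ A, x * y = y * x

/-- Free independence with respect to `τ`: every nonempty alternating product of `τ`-centred
elements of the algebras `A` and `B` is `τ`-centred. In a word, the letters tagged `true` come
from `A` and those tagged `false` from `B`. -/
def FreelyIndependent (τ : (H →L[ℂ] H) →ₗ[ℂ] ℂ) (A B : VonNeumannAlgebra H) : Prop :=
  ∀ l : List (Bool × (H →L[ℂ] H)), l ≠ [] →
    l.IsChain (fun p q => p.1 ≠ q.1) →
    (∀ p ∈ l, p.2 ∈ (if p.1 then A else B) ∧ τ p.2 = 0) →
    τ (l.map Prod.snd).prod = 0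

/-- `(M, τ)` is the tracial free product `A₁ * A₂`: it is generated by the two von Neumann
subalgebras `A₁` and `A₂`, which are freely independent. -/
structure IsFreeProduct (M : VonNeumannAlgebra H) (τ : (H →L[ℂ] H) →ₗ[ℂ] ℂ)
    (A₁ A₂ : VonNeumannAlgebra H) : Prop where
  tracialVNA : IsTracialVNA M τ
  generates : vnGen ((A₁ : Set (H →L[ℂ] H)) ∪ (A₂ : Set (H →L[ℂ] H))) = M
  free : FreelyIndependent τ A₁ A₂

/-- `y = E_B(x)`, where `E_B` is the `τ`-preserving conditional expectation onto `B`: `y` is the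
(unique) element of `B` with `τ (y b) = τ (x b)` for all `b ∈ B`. -/
def IsCondExp (τ : (H →L[ℂ] H) →ₗ[ℂ] ℂ) (B : VonNeumannAlgebra H) (x y : H →L[ℂ] H) : Prop :=
  y ∈ B ∧ ∀ b ∈ B, τ (y * b) = τ (x * b)

/-- `u` is a Haar unitary of `(M, τ)`: a unitary of `M` all of whose nonzero powers
have trace zero. -/
def IsHaarUnitary (M : VonNeumannAlgebra H) (τ : (H →L[ℂ] H) →ₗ[ℂ] ℂ) (u : H →L[ℂ] H) : Prop :=
  u ∈ M ∧ u ∈ unitary (H →L[ℂ] H) ∧ ∀ k : ℕ, k ≠ 0 → τ (u ^ k) = 0 ∧ τ (star u ^ k) = 0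

/-- The element `u` is freely independent of `B`: the von Neumann algebra `{u}''` is. -/
def ElementFreeFrom (τ : (H →L[ℂ] H) →ₗ[ℂ] ℂ) (u : H →L[ℂ] H) (B : VonNeumannAlgebra H) : Prop :=
  FreelyIndependent τ (vnGen {u}) B

/-- Popa's weak FC property of `B ⊆ M`: some Haar unitary of `M` is freely independent of `B`. -/
def WeakFC (M : VonNeumannAlgebra H) (τ : (H →L[ℂ] H) →ₗ[ℂ] ℂ) (B : VonNeumannAlgebra H) : Prop :=
  B ≤ M ∧ ∃ u : H →L[ℂ] H, IsHaarUnitary M τ u ∧ ElementFreeFrom τ u B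

end VonNeumann

/-! ### Group von Neumann algebras -/

section GroupVNA

variable {G : Type*} [Group G]

/-- The Hilbert space `ℓ²(G)`. -/
abbrev ellTwo (G : Type*) : Type _ := lp (fun _ : G => ℂ) 2

/-- The left translation `(λ_g ξ)(h) = ξ(g⁻¹ h)` as a linear isometry of `ℓ²(G)`. -/
noncomputable def leftTranslation (g : G) : ellTwo G →ₗᵢ[ℂ] ellTwo G where
  toFun ξ := ⟨fun h => ξ (g⁻¹ * h), by
    have h2 : 0 < (2 : ℝ≥0∞).toReal := by norm_num
    refine memℓp_gen ?_
    exact ((Equiv.mulLeft g⁻¹).summable_iff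
      (f := fun h => ‖ξ h‖ ^ (2 : ℝ≥0∞).toReal)).2 ((lp.memℓp ξ).summable h2)⟩
  map_add' ξ η := by ext h; rfl
  map_smul' c ξ := by ext h; rfl
  norm_map' ξ := by
    have h2 : 0 < (2 : ℝ≥0∞).toReal := by norm_num
    rw [lp.norm_eq_tsum_rpow h2, lp.norm_eq_tsum_rpow h2]
    congr 1
    exact (Equiv.mulLeft g⁻¹).tsum_eq (fun h => ‖ξ h‖ ^ (2 : ℝ≥0∞).toReal)

/-- The unitary `λ_g ∈ B(ℓ²(G))` of the left regular representation. -/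
noncomputable def leftReg (g : G) : ellTwo G →L[ℂ] ellTwo G :=
  (leftTranslation g).toContinuousLinearMap

theorem leftReg_apply (g : G) (ξ : ellTwo G) (h : G) : leftReg g ξ h = ξ (g⁻¹ * h) := rfl

/-- The basis vector `δ_e` of `ℓ²(G)`. -/
noncomputable def deltaOne (G : Type*) [Group G] : ellTwo G :=
  letI := Classical.decEq G
  lp.single 2 (1 : G) (1 : ℂ)

/-- The group von Neumann algebra `L(G) = {λ_g : g ∈ G}''`. -/
noncomputable def groupVNA (G : Type*) [Group G] : VonNeumannAlgebra (ellTwo G) :=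
  vnGen (Set.range (leftReg (G := G)))

/-- The canonical trace `τ(x) = ⟨x δ_e, δ_e⟩`. -/
noncomputable def canonicalTrace (G : Type*) [Group G] : (ellTwo G →L[ℂ] ellTwo G) →ₗ[ℂ] ℂ where
  toFun x := inner ℂ (deltaOne G) (x (deltaOne G))
  map_add' x y := by simp
  map_smul' c x := by simp

end GroupVNA

/-! ### The free group factor and its radial subalgebra -/

section FreeGroupFactor

/-- The canonical generating Haar unitaries `w_i = λ_{a_i}` of `L(F_n)`. -/
noncomputable def genUnitary {n : ℕ} (i : Fin n) :
    ellTwo (FreeGroup (Fin n)) →L[ℂ] ellTwo (FreeGroup (Fin n)) :=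
  leftReg (FreeGroup.of i)

/-- `A_i = {w_i}''`. -/
noncomputable def genAlg {n : ℕ} (i : Fin n) : VonNeumannAlgebra (ellTwo (FreeGroup (Fin n))) :=
  vnGen {genUnitary i}

/-- `B_i = {w_i + w_i*}'' ⊆ A_i`. -/
noncomputable def evenAlg {n : ℕ} (i : Fin n) : VonNeumannAlgebra (ellTwo (FreeGroup (Fin n))) :=
  vnGen {genUnitary i + star (genUnitary i)}

/-- The radial subalgebra `A_r = {∑ᵢ (w_i + w_i*)}''` of `L(F_n)`. -/
noncomputable def radialAlg (n : ℕ) : VonNeumannAlgebra (ellTwo (FreeGroup (Fin n))) :=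
  vnGen {∑ i : Fin n, (genUnitary i + star (genUnitary i))}

/-- `x ∈ A_i` corresponds to the function `f` under the trace-preserving identification
`A_i ≅ L^∞([-1,1], dt/2)` that sends `w_i` to `t ↦ exp(iπt)` (and hence `B_i` onto the even
functions): `x` and `f` have the same Fourier coefficients. -/
def CorrespondsTo {n : ℕ} (i : Fin n)
    (x : ellTwo (FreeGroup (Fin n)) →L[ℂ] ellTwo (FreeGroup (Fin n))) (f : ℝ → ℂ) : Prop :=
  x ∈ genAlg i ∧ ∀ k : ℤ,
    canonicalTrace (FreeGroup (Fin n)) (x * leftReg (FreeGroup.of i ^ (-k))) =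
      (1 / 2 : ℂ) * ∫ t in (-1 : ℝ)..1, f t * Complex.exp (-(Complex.I * Real.pi * k * t))

/-- The function `|t| / t` (its value at the null set `{0}` is irrelevant). -/
noncomputable def signFun (t : ℝ) : ℂ := ((|t| / t : ℝ) : ℂ)

end FreeGroupFactor

/-! Both halves of the theorem rest on one computation with alternating words. Let U = uv with u ∈
A_i, v ∈ A_j. A positive power of U is the word uv⋯uv and a negative one is v*u*⋯v*u*; both
alternate in centred letters of the free family A_k, so U is Haar (`IsOffPair.trace_pow`,
`IsOffPair.trace_star_pow`). For freeness, alternate nonzero powers of U with nonempty alternating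
words in centred elements of the B_k. At a junction a letter b may lie in the same A_k as the
neighbouring end of a power, and the two are merged. The products vb, u*b, bu, bv* are centred
because u and v have zero expectation. If b is a whole word caught between u* and u, or between v
and v*, then commutativity gives u*bu = b or vbv* = b, centred again. What remains is an alternating
centred word in the A_k, so its trace is zero.

`IsOffPair.freelyIndependent` passes from such words to the von Neumann algebras they generate. By
von Neumann's density theorem in ultraweak form (`normalDense_vnGen`), letters can be replaced one
at a time (`freeFamily_of_dense`). The same device derives freeness of the A_i in L(F_n) from the
normal form in a free product of groups (`freeFamily_genAlg`). The radial algebra lies in the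
algebra generated by all the B_i (`radialAlg_le`), which gives the statement about A_r.

For |t|/t, continuous functions approximating sign(sin πt) are applied to w_i, and T is a weak
ultrafilter limit (`exists_correspondsTo_signFun`). Weak limits do not respect products, so T² = 1
comes from T|s| = s, where s = (w_i − w_i*)/2i is injective. Faithfulness of the trace gives
uniqueness, and oddness of the Fourier coefficients gives zero expectation on B_i. -/

set_option linter.unusedSectionVars false

/-! ### Amplifications and von Neumann's density argument. -/

section Amplification

variable {H : Type*} [NormedAddCommGroup H] [InnerProductSpace ℂ H] [CompleteSpace H]
  {ι : Type*}

/-- The diagonal operator `x ⊕ x ⊕ ⋯` on the Hilbert sum of copies of `H`. -/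
noncomputable def ampl (x : H →L[ℂ] H) :
    lp (fun _ : ι => H) 2 →L[ℂ] lp (fun _ : ι => H) 2 :=
  LinearMap.mkContinuous
    { toFun := fun ξ => ⟨fun k => x (ξ k), by
        have h2 : 0 < (2 : ℝ≥0∞).toReal := by norm_num
        refine memℓp_gen ?_
        refine Summable.of_nonneg_of_le (fun k => by positivity) (fun k => ?_)
          (((lp.memℓp ξ).summable h2).mul_left (‖x‖ ^ (2 : ℝ≥0∞).toReal))
        rw [← Real.mul_rpow (norm_nonneg _) (norm_nonneg _)]
        exact Real.rpow_le_rpow (norm_nonneg _) (x.le_opNorm _) h2.le⟩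
      map_add' := fun ξ η => by ext k; exact map_add x _ _
      map_smul' := fun c ξ => by ext k; simp }
    ‖x‖ (fun ξ => by
      have h2 : 0 < (2 : ℝ≥0∞).toReal := by norm_num
      rw [← Real.rpow_le_rpow_iff (norm_nonneg _) (by positivity) h2,
        Real.mul_rpow (norm_nonneg _) (norm_nonneg _), lp.norm_rpow_eq_tsum h2,
        lp.norm_rpow_eq_tsum h2, ← tsum_mul_left]
      have hs := ((lp.memℓp ξ).summable h2).mul_left (‖x‖ ^ (2 : ℝ≥0∞).toReal)
      have hle : ∀ k, ‖x (ξ k)‖ ^ (2 : ℝ≥0∞).toReal ≤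
          ‖x‖ ^ (2 : ℝ≥0∞).toReal * ‖ξ k‖ ^ (2 : ℝ≥0∞).toReal := fun k => by
        rw [← Real.mul_rpow (norm_nonneg _) (norm_nonneg _)]
        exact Real.rpow_le_rpow (norm_nonneg _) (x.le_opNorm _) h2.le
      exact Summable.tsum_le_tsum hle
        (Summable.of_nonneg_of_le (fun k => by positivity) hle hs) hs)

@[simp]
theorem ampl_apply (x : H →L[ℂ] H) (ξ : lp (fun _ : ι => H) 2) (k : ι) :
    ampl x ξ k = x (ξ k) := rfl

theorem ampl_single [DecidableEq ι] (x : H →L[ℂ] H) (k : ι) (h : H) :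
    ampl x (lp.single 2 k h) = lp.single 2 k (x h) := by
  ext m
  rw [ampl_apply, lp.single_apply, lp.single_apply]
  by_cases hm : m = k
  · subst hm; simp
  · simp [hm]

theorem inner_ampl_left (x : H →L[ℂ] H) (ξ η : lp (fun _ : ι => H) 2) :
    inner ℂ (ampl x ξ) η = inner ℂ ξ (ampl (star x) η) := by
  rw [lp.inner_eq_tsum, lp.inner_eq_tsum]
  congr 1
  funext k
  rw [ampl_apply, ampl_apply, ContinuousLinearMap.star_eq_adjoint,
    ContinuousLinearMap.adjoint_inner_right]

/-- The matrix entry `(k, m)` of an operator on the Hilbert sum of copies of `H`. -/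
noncomputable def matrixEntry [DecidableEq ι]
    (P : lp (fun _ : ι => H) 2 →L[ℂ] lp (fun _ : ι => H) 2) (k m : ι) : H →L[ℂ] H :=
  (lp.evalCLM ℂ (fun _ : ι => H) 2 k) ∘L P ∘L
    (lp.singleContinuousLinearMap ℂ (fun _ : ι => H) 2 m)

theorem matrixEntry_apply [DecidableEq ι]
    (P : lp (fun _ : ι => H) 2 →L[ℂ] lp (fun _ : ι => H) 2) (k m : ι) (h : H) :
    matrixEntry P k m h = P (lp.single 2 m h) k := rfl

theorem hasSum_matrixEntry [DecidableEq ι]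
    (P : lp (fun _ : ι => H) 2 →L[ℂ] lp (fun _ : ι => H) 2) (k : ι)
    (ξ : lp (fun _ : ι => H) 2) :
    HasSum (fun m => matrixEntry P k m (ξ m)) (P ξ k) := by
  have h := lp.hasSum_single (E := fun _ : ι => H) (p := 2) (by norm_num) ξ
  exact ((lp.evalCLM ℂ (fun _ : ι => H) 2 k) ∘L P).hasSum h

/-- Whatever commutes with the commutant of `S` commutes, after amplification, with every
operator that commutes with the amplification of `S`. -/
theorem ampl_comm_of_mem_bicommutant {S : Set (H →L[ℂ] H)} {x : H →L[ℂ] H}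
    (hx : x ∈ Set.centralizer (Set.centralizer S))
    {P : lp (fun _ : ι => H) 2 →L[ℂ] lp (fun _ : ι => H) 2}
    (hP : ∀ s ∈ S, ∀ ξ, ampl s (P ξ) = P (ampl s ξ)) (ξ : lp (fun _ : ι => H) 2) :
    ampl x (P ξ) = P (ampl x ξ) := by
  classical
  -- An operator commutes with a diagonal `ampl s` exactly when each of its matrix entries commutes
  -- with `s`.
  have hc : ∀ k m, matrixEntry P k m ∈ Set.centralizer S := by
    intro k m s hs
    ext h
    have := congrArg (fun η : lp (fun _ : ι => H) 2 => η k) (hP s hs (lp.single 2 m h))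
    simpa [matrixEntry_apply, ampl_single] using this
  ext k
  have h1 : HasSum (fun m => x (matrixEntry P k m (ξ m))) (x (P ξ k)) :=
    x.hasSum (hasSum_matrixEntry P k ξ)
  have h2 : HasSum (fun m => matrixEntry P k m (x (ξ m))) (P (ampl x ξ) k) :=
    hasSum_matrixEntry P k (ampl x ξ)
  have h3 : (fun m => x (matrixEntry P k m (ξ m))) = fun m => matrixEntry P k m (x (ξ m)) := by
    funext m
    exact (congrArg (fun T : H →L[ℂ] H => T (ξ m)) (hx _ (hc k m))).symm
  rw [h3] at h1
  exact h1.unique h2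

/-- An orthogonality form of von Neumann's density theorem. -/
theorem inner_ampl_eq_zero_of_mem_bicommutant {S : Set (H →L[ℂ] H)} (h1 : 1 ∈ S)
    (hmul : ∀ x ∈ S, ∀ y ∈ S, x * y ∈ S) (hstar : ∀ x ∈ S, star x ∈ S)
    {x : H →L[ℂ] H} (hx : x ∈ Set.centralizer (Set.centralizer S))
    (η ζ : lp (fun _ : ι => H) 2) (h : ∀ s ∈ S, inner ℂ η (ampl s ζ) = 0) :
    inner ℂ η (ampl x ζ) = 0 := by
  set V : Submodule ℂ (lp (fun _ : ι => H) 2) :=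
    Submodule.span ℂ ((fun s => ampl s ζ) '' S) with hV
  set K := V.topologicalClosure with hK
  have : CompleteSpace K := V.isClosed_topologicalClosure.completeSpace_coe
  have hinv : ∀ s ∈ S, ∀ ξ ∈ K, ampl s ξ ∈ K := by
    intro s hs ξ hξ
    have hVs : V ≤ V.comap (ampl s).toLinearMap := by
      rw [hV, Submodule.span_le]
      rintro _ ⟨t, ht, rfl⟩
      exact Submodule.subset_span ⟨s * t, hmul s hs t ht, rfl⟩
    have : Set.MapsTo (ampl s) (closure (V : Set (lp (fun _ : ι => H) 2)))
        (closure (V : Set (lp (fun _ : ι => H) 2))) :=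
      Set.MapsTo.closure (fun ξ hξ => hVs hξ) (ampl s).continuous
    rw [hK, ← SetLike.mem_coe, Submodule.topologicalClosure_coe] at hξ ⊢
    exact this hξ
  -- `S` is self-adjoint, so the orthogonal complement of `K` is invariant too and the projection
  -- onto `K` commutes with the amplified `S`.
  have hP : ∀ s ∈ S, ∀ ξ, ampl s (K.starProjection ξ) = K.starProjection (ampl s ξ) := by
    intro s hs ξ
    refine (Submodule.eq_starProjection_of_mem_orthogonal
      (hinv s hs _ (K.starProjection_apply_mem ξ)) ?_).symm
    rw [← map_sub, Submodule.mem_orthogonal']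
    intro κ hκ
    rw [inner_ampl_left]
    exact Submodule.mem_orthogonal' _ _ |>.1 (K.sub_starProjection_mem_orthogonal ξ) _
      (hinv _ (hstar s hs) κ hκ)
  have hζ : ζ ∈ K := V.le_topologicalClosure (Submodule.subset_span ⟨1, h1, rfl⟩)
  have hxζ : ampl x ζ ∈ K := by
    rw [← Submodule.starProjection_eq_self_iff (K := K)] at hζ ⊢
    rw [← ampl_comm_of_mem_bicommutant hx hP, hζ]
  have hη : V ≤ (Submodule.span ℂ {η})ᗮ := by
    rw [hV, Submodule.span_le]
    rintro _ ⟨s, hs, rfl⟩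
    exact (Submodule.mem_orthogonal_singleton_iff_inner_right).2 (h s hs)
  have hKη : K ≤ (Submodule.span ℂ {η})ᗮ :=
    Submodule.topologicalClosure_minimal _ hη (Submodule.isClosed_orthogonal _)
  exact (Submodule.mem_orthogonal_singleton_iff_inner_right).1 (hKη hxζ)

end Amplification

/-! ### Ultraweakly continuous functionals and ultraweak density. -/

section Normal

variable {H : Type*} [NormedAddCommGroup H] [InnerProductSpace ℂ H] [CompleteSpace H]

/-- The functional `f` is ultraweakly continuous on `M`: it is given on `M` by
`x ↦ ∑ₖ ⟪ηₖ, x ζₖ⟫` for square-summable families of vectors. -/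
def NormalOn (M : Set (H →L[ℂ] H)) (f : (H →L[ℂ] H) →ₗ[ℂ] ℂ) : Prop :=
  ∃ (ι : Type) (η ζ : ι → H), Summable (fun k => ‖η k‖ ^ 2) ∧ Summable (fun k => ‖ζ k‖ ^ 2) ∧
    ∀ x ∈ M, HasSum (fun k => inner ℂ (η k) (x (ζ k))) (f x)

theorem IsTracialVNA.normalOn {M : VonNeumannAlgebra H} {τ : (H →L[ℂ] H) →ₗ[ℂ] ℂ}
    (h : IsTracialVNA M τ) : NormalOn (M : Set (H →L[ℂ] H)) τ := by
  obtain ⟨ξ, hξ, hx⟩ := h.normal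
  exact ⟨ℕ, ξ, ξ, hξ, hξ, hx⟩

theorem Summable.norm_clm_apply_sq {ι : Type*} {η : ι → H} (h : Summable (fun k => ‖η k‖ ^ 2))
    (x : H →L[ℂ] H) : Summable (fun k => ‖x (η k)‖ ^ 2) := by
  refine Summable.of_nonneg_of_le (fun k => by positivity) (fun k => ?_) (h.mul_left (‖x‖ ^ 2))
  rw [← mul_pow]
  exact pow_le_pow_left₀ (norm_nonneg _) (x.le_opNorm _) 2

/-- The outer factors are absorbed into the vectors, `star a` on the left and `b` on the right. This
lets a single letter of a word vary while the others stay fixed. -/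
theorem NormalOn.comp_mul {M : VonNeumannAlgebra H} {f : (H →L[ℂ] H) →ₗ[ℂ] ℂ}
    (hf : NormalOn (M : Set (H →L[ℂ] H)) f) {a b : H →L[ℂ] H} (ha : a ∈ M) (hb : b ∈ M) :
    NormalOn (M : Set (H →L[ℂ] H))
      (f ∘ₗ LinearMap.mulLeft ℂ a ∘ₗ LinearMap.mulRight ℂ b) := by
  obtain ⟨ι, η, ζ, hη, hζ, h⟩ := hf
  refine ⟨ι, fun k => star a (η k), fun k => b (ζ k), hη.norm_clm_apply_sq _,
    hζ.norm_clm_apply_sq _, fun x hx => ?_⟩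
  have := h (a * (x * b)) (mul_mem ha (mul_mem hx hb))
  simpa [ContinuousLinearMap.star_eq_adjoint, ContinuousLinearMap.adjoint_inner_left] using this

theorem NormalOn.smul {M : Set (H →L[ℂ] H)} {f : (H →L[ℂ] H) →ₗ[ℂ] ℂ}
    (hf : NormalOn M f) (c : ℂ) : NormalOn M (c • f) := by
  obtain ⟨ι, η, ζ, hη, hζ, h⟩ := hf
  refine ⟨ι, η, fun k => c • ζ k, hη, ?_, fun x hx => ?_⟩
  · simpa [norm_smul, mul_pow] using hζ.mul_left (‖c‖ ^ 2)
  · simpa [inner_smul_right] using (h x hx).mul_left c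

theorem NormalOn.add {M : Set (H →L[ℂ] H)} {f g : (H →L[ℂ] H) →ₗ[ℂ] ℂ}
    (hf : NormalOn M f) (hg : NormalOn M g) : NormalOn M (f + g) := by
  obtain ⟨ι, η, ζ, hη, hζ, h⟩ := hf
  obtain ⟨κ, η', ζ', hη', hζ', h'⟩ := hg
  refine ⟨ι ⊕ κ, Sum.elim η η', Sum.elim ζ ζ', ?_, ?_, fun x hx => ?_⟩
  · exact (HasSum.sum (by simpa [Function.comp_def] using hη.hasSum)
      (by simpa [Function.comp_def] using hη'.hasSum)).summable
  · exact (HasSum.sum (by simpa [Function.comp_def] using hζ.hasSum)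
      (by simpa [Function.comp_def] using hζ'.hasSum)).summable
  · exact HasSum.sum (by simpa [Function.comp_def] using h x hx)
      (by simpa [Function.comp_def] using h' x hx)

theorem NormalOn.sub {M : Set (H →L[ℂ] H)} {f g : (H →L[ℂ] H) →ₗ[ℂ] ℂ}
    (hf : NormalOn M f) (hg : NormalOn M g) : NormalOn M (f - g) := by
  have := hf.add (hg.smul (-1))
  rwa [neg_one_smul, ← sub_eq_add_neg] at this

theorem subset_vnGen (S : Set (H →L[ℂ] H)) : S ⊆ vnGen S := by
  rw [coe_vnGen]
  exact Set.subset_union_left.trans Set.subset_centralizer_centralizer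

theorem vnGen_le {S : Set (H →L[ℂ] H)} {M : VonNeumannAlgebra H} (h : S ⊆ M) :
    vnGen S ≤ M := by
  have hS : S ∪ star S ⊆ M := by
    refine Set.union_subset h fun x hx => ?_
    simpa using star_mem (h hx)
  intro x hx
  rw [← SetLike.mem_coe, coe_vnGen] at hx
  rw [← SetLike.mem_coe, ← M.centralizer_centralizer]
  exact Set.centralizer_subset (Set.centralizer_subset hS) hx

/-- The set `S` has ultraweakly dense span in `A`, as far as functionals on `M` can tell. -/
def NormalDense (M S A : Set (H →L[ℂ] H)) : Prop :=
  ∀ f : (H →L[ℂ] H) →ₗ[ℂ] ℂ, NormalOn M f → (∀ s ∈ S, f s = 0) → ∀ x ∈ A, f x = 0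

/-- **Von Neumann's density theorem**: a self-adjoint monoid of operators spans an ultraweakly
dense subspace of its bicommutant. -/
theorem normalDense_vnGen {S : Set (H →L[ℂ] H)} {M : VonNeumannAlgebra H} (hSM : S ⊆ M)
    (h1 : 1 ∈ S) (hmul : ∀ x ∈ S, ∀ y ∈ S, x * y ∈ S) (hstar : ∀ x ∈ S, star x ∈ S) :
    NormalDense (M : Set (H →L[ℂ] H)) S (vnGen S) := by
  rintro f ⟨ι, η, ζ, hη, hζ, h⟩ hS x hx
  have hmem : ∀ ξ : ι → H, Summable (fun k => ‖ξ k‖ ^ 2) → Memℓp ξ 2 := fun ξ hξ =>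
    memℓp_gen (by simpa using hξ)
  have hSS : S ∪ star S = S :=
    Set.union_eq_self_of_subset_right fun y hy => by simpa using hstar _ hy
  have hx' : x ∈ Set.centralizer (Set.centralizer S) := by
    rwa [coe_vnGen, hSS] at hx
  have key : ∀ y ∈ M, f y = inner ℂ (⟨η, hmem η hη⟩ : lp (fun _ : ι => H) 2)
      (ampl y ⟨ζ, hmem ζ hζ⟩) := fun y hy => by
    rw [lp.inner_eq_tsum, ← (h y hy).tsum_eq]
    rfl
  rw [key x (vnGen_le hSM hx)]
  refine inner_ampl_eq_zero_of_mem_bicommutant h1 hmul hstar hx' _ _ fun s hs => ?_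
  rw [← key s (hSM hs), hS s hs]

theorem NormalDense.mono {M S T A : Set (H →L[ℂ] H)} (h : NormalDense M S A)
    (hST : S ⊆ Submodule.span ℂ T) : NormalDense M T A := fun f hf hT =>
  h f hf fun s hs => by
    have : Submodule.span ℂ T ≤ LinearMap.ker f := Submodule.span_le.2 hT
    exact this (hST hs)

end Normal

/-! ### Alternating words, and freeness tested on generators. -/

section Words

variable {H : Type*} [NormedAddCommGroup H] [InnerProductSpace ℂ H] [CompleteSpace H]
  {ι : Type*}

/-- Free independence of a family of sets: every nonempty alternating product of centred
elements is centred. -/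
def FreeFamily (τ : (H →L[ℂ] H) →ₗ[ℂ] ℂ) (A : ι → Set (H →L[ℂ] H)) : Prop :=
  ∀ l : List (ι × (H →L[ℂ] H)), l ≠ [] →
    l.IsChain (fun p q => p.1 ≠ q.1) →
    (∀ p ∈ l, p.2 ∈ A p.1 ∧ τ p.2 = 0) →
    τ (l.map Prod.snd).prod = 0

/-- `AltFrom τ A o y`: the operator `y` is an alternating product of centred elements of the
sets `A k`; the index of the first letter is `o`, which is `none` for the empty product. -/
inductive AltFrom (τ : (H →L[ℂ] H) →ₗ[ℂ] ℂ) (A : ι → Set (H →L[ℂ] H)) :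
    Option ι → (H →L[ℂ] H) → Prop
  | one : AltFrom τ A none 1
  | mul {k : ι} {c : H →L[ℂ] H} {o : Option ι} {r : H →L[ℂ] H} :
      c ∈ A k → τ c = 0 → o ≠ some k → AltFrom τ A o r → AltFrom τ A (some k) (c * r)

variable {τ : (H →L[ℂ] H) →ₗ[ℂ] ℂ} {A G : ι → Set (H →L[ℂ] H)} {M : VonNeumannAlgebra H}

theorem AltFrom.exists_list {o : Option ι} {y : H →L[ℂ] H} (h : AltFrom τ A o y) :
    ∃ l : List (ι × (H →L[ℂ] H)), l.IsChain (fun p q => p.1 ≠ q.1) ∧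
      (∀ p ∈ l, p.2 ∈ A p.1 ∧ τ p.2 = 0) ∧ l.head?.map Prod.fst = o ∧
      (l.map Prod.snd).prod = y := by
  induction h with
  | one => exact ⟨[], by simp⟩
  | @mul k c o r hc h0 ho _ ih =>
    obtain ⟨l, hl, hA, hh, hp⟩ := ih
    refine ⟨(k, c) :: l, ?_, ?_, by simp, by simp [hp]⟩
    · cases l with
      | nil => simp
      | cons p l =>
        refine List.IsChain.cons_cons ?_ hl
        rintro rfl
        exact ho (by simpa using hh.symm)
    · intro p hp
      rcases List.mem_cons.1 hp with rfl | hp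
      · exact ⟨hc, h0⟩
      · exact hA p hp

theorem FreeFamily.trace_eq_zero (hF : FreeFamily τ A) {k : ι} {y : H →L[ℂ] H}
    (h : AltFrom τ A (some k) y) : τ y = 0 := by
  obtain ⟨l, hl, hA, hh, rfl⟩ := h.exists_list
  refine hF l ?_ hl hA
  rintro rfl
  simp at hh

theorem AltFrom.mem {o : Option ι} {y : H →L[ℂ] H} (h : AltFrom τ A o y)
    (hA : ∀ k, A k ⊆ M) : y ∈ M := by
  induction h with
  | one => exact one_mem M
  | mul hc _ _ _ ih => exact mul_mem (hA _ hc) ih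

theorem AltFrom.eq_one {y : H →L[ℂ] H} (h : AltFrom τ A none y) : y = 1 := by
  cases h; rfl

/-- Replacement of one generator by an element of the generated algebra. -/
theorem trace_mul_eq_zero_of_dense (hτ : NormalOn (M : Set (H →L[ℂ] H)) τ) (h1 : τ 1 = 1)
    (hGM : ∀ k, G k ⊆ M) (hd : ∀ k, NormalDense (M : Set (H →L[ℂ] H)) (insert 1 (G k)) (A k))
    (hG0 : ∀ k, ∀ g ∈ G k, τ g = 0) {a : H →L[ℂ] H} (ha : a ∈ M) {k : ι}
    (hgood : ∀ s, AltFrom τ G (some k) s → τ (a * s) = 0) {c : H →L[ℂ] H} (hc : c ∈ A k)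
    (hc0 : τ c = 0) {o : Option ι} {s : H →L[ℂ] H} (ho : o ≠ some k) (hs : AltFrom τ G o s) :
    τ (a * c * s) = 0 := by
  have hsM : s ∈ M := hs.mem hGM
  -- The functional is x ↦ τ(axs) − τ(as)τ(x). The correction term makes it vanish at 1, and on `G
  -- k` both terms are zero; at the centred `c` its value is τ(acs).
  have hf := hd k _ ((hτ.comp_mul ha hsM).sub (hτ.smul (τ (a * s)))) ?_ c hc
  · simpa [hc0, mul_assoc] using hf
  · intro g hg
    rcases Set.mem_insert_iff.1 hg with rfl | hg
    · simp [h1]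
    · have := hgood (g * s) (AltFrom.mul hg (hG0 k g hg) ho hs)
      simp [hG0 k g hg, this]

/-- Freeness may be tested on alternating words in generating sets of centred elements. -/
theorem freeFamily_of_dense (hτ : NormalOn (M : Set (H →L[ℂ] H)) τ) (h1 : τ 1 = 1)
    (hGM : ∀ k, G k ⊆ M) (hAM : ∀ k, A k ⊆ M)
    (hd : ∀ k, NormalDense (M : Set (H →L[ℂ] H)) (insert 1 (G k)) (A k))
    (hG0 : ∀ k, ∀ g ∈ G k, τ g = 0)
    (hG : ∀ k y, AltFrom τ G (some k) y → τ y = 0) : FreeFamily τ A := by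
  -- Letters are replaced from left to right: `a` is the part already taken from the `A k`, with
  -- last index `m`, and it must annihilate every generator word that may legally follow it.
  have main : ∀ (l : List (ι × (H →L[ℂ] H))) (m : ι) (a : H →L[ℂ] H), a ∈ M →
      (∀ o s, o ≠ some m → AltFrom τ G o s → τ (a * s) = 0) →
      ((m, a) :: l).IsChain (fun p q => p.1 ≠ q.1) →
      (∀ p ∈ l, p.2 ∈ A p.1 ∧ τ p.2 = 0) → τ (a * (l.map Prod.snd).prod) = 0 := by
    intro l
    induction l with
    | nil =>
      intro m a _ hgood _ _
      simpa using hgood none 1 (by simp) AltFrom.one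
    | cons p l ih =>
      obtain ⟨k, c⟩ := p
      intro m a ha hgood hch hl
      obtain ⟨hc, hc0⟩ := hl (k, c) (by simp)
      rw [List.isChain_cons_cons] at hch
      have hmk : m ≠ k := hch.1
      have := ih k (a * c) (mul_mem ha (hAM k hc))
        (fun o s ho hs => trace_mul_eq_zero_of_dense hτ h1 hGM hd hG0 ha
          (fun s hs => hgood _ s (by simpa using hmk.symm) hs) hc hc0 ho hs)
        (by
          cases l with
          | nil => simp
          | cons q l =>
            rw [List.isChain_cons_cons] at hch ⊢
            exact hch.2)
        (fun p hp => hl p (List.mem_cons_of_mem _ hp))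
      simpa [mul_assoc] using this
  intro l hne hch hl
  cases l with
  | nil => exact absurd rfl hne
  | cons p l =>
    obtain ⟨k, c⟩ := p
    obtain ⟨hc, hc0⟩ := hl (k, c) (by simp)
    have := main l k c (hAM k hc)
      (fun o s ho hs => by
        have := trace_mul_eq_zero_of_dense hτ h1 hGM hd hG0 (one_mem M)
          (fun s hs => by simpa using hG k s hs) hc hc0 ho hs
        simpa using this)
      hch (fun p hp => hl p (List.mem_cons_of_mem _ hp))
    simpa using this

theorem smul_mem_vna {c : ℂ} {x : H →L[ℂ] H} (hx : x ∈ M) : c • x ∈ M :=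
  M.toStarSubalgebra.smul_mem hx c

theorem sub_trace_mem {x : H →L[ℂ] H} (hx : x ∈ M) : x - τ x • 1 ∈ M :=
  sub_mem hx (smul_mem_vna (one_mem M))

theorem trace_sub_trace (h1 : τ 1 = 1) (x : H →L[ℂ] H) : τ (x - τ x • 1) = 0 := by
  simp [h1]

/-- The span of the alternating words is stable under left multiplication by letters. -/
theorem mul_mem_span_altFrom (h1 : τ 1 = 1) {B : ι → VonNeumannAlgebra H} {k : ι}
    {b y : H →L[ℂ] H} (hb : b ∈ B k)
    (hy : y ∈ Submodule.span ℂ {y | ∃ o, AltFrom τ (fun k => (B k : Set (H →L[ℂ] H))) o y}) :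
    b * y ∈ Submodule.span ℂ {y | ∃ o, AltFrom τ (fun k => (B k : Set (H →L[ℂ] H))) o y} := by
  set W := Submodule.span ℂ {y | ∃ o, AltFrom τ (fun k => (B k : Set (H →L[ℂ] H))) o y}
  have step : ∀ (x r : H →L[ℂ] H) (o : Option ι), x ∈ B k → o ≠ some k →
      -- Split `x` into its centred part and a scalar: the first extends the word and the second
      -- only rescales it.
      AltFrom τ (fun k => (B k : Set (H →L[ℂ] H))) o r → x * r ∈ W := by
    intro x r o hx ho hr
    have : x * r = (x - τ x • 1) * r + τ x • r := by
      rw [sub_mul, smul_mul_assoc, one_mul, sub_add_cancel]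
    rw [this]
    refine add_mem (Submodule.subset_span ⟨some k, ?_⟩)
      (Submodule.smul_mem _ _ (Submodule.subset_span ⟨o, hr⟩))
    exact AltFrom.mul (sub_trace_mem hx) (trace_sub_trace h1 x) ho hr
  have hle : W ≤ W.comap (LinearMap.mulLeft ℂ b) := by
    refine Submodule.span_le.2 ?_
    rintro y ⟨o, hy⟩
    change b * y ∈ W
    by_cases ho : o = some k
    · subst ho
      cases hy with
      | mul hc _ ho hr =>
        rw [← mul_assoc]
        exact step _ _ _ (mul_mem hb hc) ho hr
    · exact step _ _ _ hb ho hy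
  exact hle hy

/-- Alternating words in centred elements of the `B k` are dense in the algebra they
generate. -/
theorem normalDense_altFrom (h1 : τ 1 = 1) {B : ι → VonNeumannAlgebra H} (hB : ∀ k, B k ≤ M) :
    NormalDense (M : Set (H →L[ℂ] H))
      (insert 1 {y | ∃ k, AltFrom τ (fun k => (B k : Set (H →L[ℂ] H))) (some k) y})
      (vnGen (⋃ k, (B k : Set (H →L[ℂ] H)))) := by
  set S := Submonoid.closure (⋃ k, (B k : Set (H →L[ℂ] H)))
  have hgen : ∀ x ∈ ⋃ k, (B k : Set (H →L[ℂ] H)), star x ∈ ⋃ k, (B k : Set (H →L[ℂ] H)) := by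
    intro x hx
    obtain ⟨k, hk⟩ := Set.mem_iUnion.1 hx
    exact Set.mem_iUnion.2 ⟨k, star_mem (s := B k) hk⟩
  have hSM : (S : Set (H →L[ℂ] H)) ⊆ M := by
    intro x hx
    induction hx using Submonoid.closure_induction with
    | mem x hx =>
      obtain ⟨k, hk⟩ := Set.mem_iUnion.1 hx
      exact hB k hk
    | one => exact one_mem M
    | mul x y _ _ hx hy => exact mul_mem (s := M) hx hy
  have hstar : ∀ x ∈ S, star x ∈ S := by
    intro x hx
    induction hx using Submonoid.closure_induction with
    | mem x hx => exact Submonoid.subset_closure (hgen x hx)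
    | one => simp [one_mem]
    | mul x y _ _ hx hy => rw [star_mul]; exact mul_mem hy hx
  have hd := normalDense_vnGen hSM (one_mem S) (fun x hx y hy => mul_mem hx hy) hstar
  have hspan : (S : Set (H →L[ℂ] H)) ⊆ Submodule.span ℂ
      {y | ∃ o, AltFrom τ (fun k => (B k : Set (H →L[ℂ] H))) o y} := by
    intro x hx
    induction hx using Submonoid.closure_induction_left with
    | one => exact Submodule.subset_span ⟨none, AltFrom.one⟩
    | mul_left x hx y _ hy =>
      obtain ⟨k, hk⟩ := Set.mem_iUnion.1 hx
      exact mul_mem_span_altFrom h1 hk hy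
  have hle : vnGen (⋃ k, (B k : Set (H →L[ℂ] H))) ≤ vnGen (S : Set (H →L[ℂ] H)) :=
    vnGen_le (Submonoid.subset_closure.trans (subset_vnGen _))
  refine fun f hf h0 x hx => hd.mono hspan f hf ?_ x (hle hx)
  rintro y ⟨o, hy⟩
  cases o with
  | none => rw [hy.eq_one]; exact h0 1 (Set.mem_insert _ _)
  | some k => exact h0 y (Set.mem_insert_of_mem _ ⟨k, hy⟩)

/-- The nonzero powers of a unitary, together with `1`, are dense in the algebra it
generates. -/
theorem normalDense_powers {U : H →L[ℂ] H} (hU : U ∈ unitary (H →L[ℂ] H)) (hUM : U ∈ M) :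
    NormalDense (M : Set (H →L[ℂ] H))
      (insert 1 {x | ∃ n : ℕ, n ≠ 0 ∧ (x = U ^ n ∨ x = star U ^ n)}) (vnGen {U}) := by
  set V : unitary (H →L[ℂ] H) := ⟨U, hU⟩
  have hpow : ∀ k : ℤ, ((V ^ k : unitary (H →L[ℂ] H)) : H →L[ℂ] H) ∈
      insert 1 {x | ∃ n : ℕ, n ≠ 0 ∧ (x = U ^ n ∨ x = star U ^ n)} := by
    intro k
    obtain ⟨n, rfl | rfl⟩ := k.eq_nat_or_neg
    all_goals
      rcases eq_or_ne n 0 with rfl | hn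
      · simp
      refine Set.mem_insert_of_mem _ ⟨n, hn, ?_⟩
      simp [V, ← Unitary.star_eq_inv]
  -- Integer exponents exhibit the powers as a self-adjoint group, as the density theorem requires.
  set S : Set (H →L[ℂ] H) := Set.range fun k : ℤ => ((V ^ k : unitary (H →L[ℂ] H)) : H →L[ℂ] H)
  have hd : NormalDense (M : Set (H →L[ℂ] H)) S (vnGen S) := by
    refine normalDense_vnGen ?_ ⟨0, by simp⟩ ?_ ?_
    · rintro _ ⟨k, rfl⟩
      rcases Set.mem_insert_iff.1 (hpow k) with h | ⟨n, -, h | h⟩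
      · simp only [h]; exact one_mem M
      · simp only [h]; exact pow_mem hUM n
      · simp only [h]; exact pow_mem (star_mem hUM) n
    · rintro _ ⟨k, rfl⟩ _ ⟨m, rfl⟩
      exact ⟨k + m, by simp [zpow_add]⟩
    · rintro _ ⟨k, rfl⟩
      refine ⟨-k, ?_⟩
      simp only [zpow_neg, ← Unitary.star_eq_inv]
      rfl
  have hle : vnGen {U} ≤ vnGen S :=
    vnGen_le (Set.singleton_subset_iff.2 (subset_vnGen S ⟨1, by simp [V]⟩))
  refine fun f hf h0 x hx => hd f hf ?_ x (hle hx)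
  rintro _ ⟨k, rfl⟩
  exact h0 _ (hpow k)

end Words

/-! ### Powers of `u * v` against words in the subalgebras `B k`. -/

section FreeProducts

variable {H : Type*} [NormedAddCommGroup H] [InnerProductSpace ℂ H] [CompleteSpace H]
  {ι : Type*} {τ : (H →L[ℂ] H) →ₗ[ℂ] ℂ} {A B : ι → VonNeumannAlgebra H} {i j : ι}
  {u v : H →L[ℂ] H}

/-- The unitaries `u ∈ A i` and `v ∈ A j` of two different abelian algebras have zero expectation
on the subalgebras `B i` and `B j`. -/
structure IsOffPair (τ : (H →L[ℂ] H) →ₗ[ℂ] ℂ) (A B : ι → VonNeumannAlgebra H) (i j : ι)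
    (u v : H →L[ℂ] H) : Prop where
  ne : i ≠ j
  le : ∀ k, B k ≤ A k
  comm : ∀ k, IsAbelianVNA (A k)
  mem_left : u ∈ A i
  mem_right : v ∈ A j
  unitary_left : u ∈ unitary (H →L[ℂ] H)
  unitary_right : v ∈ unitary (H →L[ℂ] H)
  trace_left : ∀ b ∈ B i, τ (u * b) = 0
  trace_star_left : ∀ b ∈ B i, τ (star u * b) = 0
  trace_right : ∀ b ∈ B j, τ (v * b) = 0
  trace_star_right : ∀ b ∈ B j, τ (star v * b) = 0

/-- Since (uv)* = v*u*, this symmetry turns each statement about positive powers into one about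
negative powers. -/
theorem IsOffPair.swap (h : IsOffPair τ A B i j u v) :
    IsOffPair τ A B j i (star v) (star u) where
  ne := h.ne.symm
  le := h.le
  comm := h.comm
  mem_left := star_mem h.mem_right
  mem_right := star_mem h.mem_left
  unitary_left := Unitary.star_mem h.unitary_right
  unitary_right := Unitary.star_mem h.unitary_left
  trace_left := h.trace_star_right
  trace_star_left := by simpa using h.trace_right
  trace_right := h.trace_star_left
  trace_star_right := by simpa using h.trace_left

theorem IsOffPair.trace_left_eq_zero (h : IsOffPair τ A B i j u v) : τ u = 0 := by
  simpa using h.trace_left 1 (one_mem _)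

theorem IsOffPair.trace_right_eq_zero (h : IsOffPair τ A B i j u v) : τ v = 0 := by
  simpa using h.trace_right 1 (one_mem _)

/-- A centred letter of `A k` that stays centred when a power of `u * v` is put before it. -/
structure IsLetter (τ : (H →L[ℂ] H) →ₗ[ℂ] ℂ) (A : ι → VonNeumannAlgebra H) (i j : ι)
    (u v : H →L[ℂ] H) (k : ι) (c : H →L[ℂ] H) : Prop where
  mem : c ∈ A k
  trace : τ c = 0
  trace_right : k = j → τ (v * c) = 0
  trace_left : k = i → τ (star u * c) = 0

theorem IsLetter.swap {k : ι} {c : H →L[ℂ] H} (h : IsLetter τ A i j u v k c) :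
    IsLetter τ A j i (star v) (star u) k c :=
  ⟨h.mem, h.trace, h.trace_left, by simpa using h.trace_right⟩

theorem isLetter_swap {k : ι} {c : H →L[ℂ] H} :
    IsLetter τ A j i (star v) (star u) k c ↔ IsLetter τ A i j u v k c :=
  ⟨fun h => by simpa using h.swap, IsLetter.swap⟩

theorem IsOffPair.isLetter (h : IsOffPair τ A B i j u v) {k : ι} {b : H →L[ℂ] H}
    (hb : b ∈ B k) (h0 : τ b = 0) : IsLetter τ A i j u v k b where
  mem := h.le k hb
  trace := h0
  trace_right := by rintro rfl; exact h.trace_right b hb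
  trace_left := by rintro rfl; exact h.trace_star_left b hb

/-- The one place where merging happens on both sides: in the abelian algebra `A i` one has u*(bu) =
b, which is centred. -/
theorem IsOffPair.isLetter_mul (h : IsOffPair τ A B i j u v) {b : H →L[ℂ] H}
    (hb : b ∈ B i) (h0 : τ b = 0) : IsLetter τ A i j u v i (b * u) where
  mem := mul_mem (h.le i hb) h.mem_left
  trace := by rw [h.comm i b (h.le i hb) u h.mem_left]; exact h.trace_left b hb
  trace_right hij := absurd hij h.ne
  trace_left _ := by
    rw [h.comm i b (h.le i hb) u h.mem_left, ← mul_assoc, Unitary.star_mul_self_of_mem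
      h.unitary_left, one_mul, h0]

/-- Products that begin with a positive power of `u * v`. -/
def StartsPow (τ : (H →L[ℂ] H) →ₗ[ℂ] ℂ) (A : ι → VonNeumannAlgebra H) (i : ι)
    (u y : H →L[ℂ] H) : Prop :=
  ∃ (o : Option ι) (r : H →L[ℂ] H), o ≠ some i ∧
    AltFrom τ (fun k => (A k : Set (H →L[ℂ] H))) o r ∧ y = u * r

/-- Products that begin with a letter from `B k`, possibly merged with its right neighbour. -/
def StartsLetter (τ : (H →L[ℂ] H) →ₗ[ℂ] ℂ) (A : ι → VonNeumannAlgebra H) (i j : ι)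
    (u v : H →L[ℂ] H) (k : ι) (y : H →L[ℂ] H) : Prop :=
  ∃ (c : H →L[ℂ] H) (o : Option ι) (r : H →L[ℂ] H), IsLetter τ A i j u v k c ∧ o ≠ some k ∧
    AltFrom τ (fun k => (A k : Set (H →L[ℂ] H))) o r ∧ y = c * r

theorem StartsLetter.altFrom {k : ι} {y : H →L[ℂ] H} (h : StartsLetter τ A i j u v k y) :
    AltFrom τ (fun k => (A k : Set (H →L[ℂ] H))) (some k) y := by
  obtain ⟨c, o, r, hc, ho, hr, rfl⟩ := h
  exact AltFrom.mul hc.mem hc.trace ho hr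

theorem startsLetter_swap {k : ι} {y : H →L[ℂ] H} :
    StartsLetter τ A j i (star v) (star u) k y ↔ StartsLetter τ A i j u v k y := by
  simp only [StartsLetter, isLetter_swap]

theorem IsOffPair.altFrom_of_startsPow (h : IsOffPair τ A B i j u v) {y : H →L[ℂ] H}
    (hy : StartsPow τ A i u y) : AltFrom τ (fun k => (A k : Set (H →L[ℂ] H))) (some i) y := by
  obtain ⟨o, r, ho, hr, rfl⟩ := hy
  exact AltFrom.mul h.mem_left h.trace_left_eq_zero ho hr

/-- A word in the algebras `B k` followed by a positive power of `u * v`. -/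
theorem IsOffPair.startsLetter_mul_pow (h : IsOffPair τ A B i j u v) {k : ι} {b y : H →L[ℂ] H}
    (hb : b ∈ B k) (h0 : τ b = 0) (hy : StartsPow τ A i u y) :
    StartsLetter τ A i j u v k (b * y) := by
  by_cases hk : k = i
  · subst hk
    obtain ⟨o, r, ho, hr, rfl⟩ := hy
    exact ⟨b * u, o, r, h.isLetter_mul hb h0, ho, hr, (mul_assoc _ _ _).symm⟩
  · exact ⟨b, some i, y, h.isLetter hb h0, by simpa using Ne.symm hk,
      h.altFrom_of_startsPow hy, rfl⟩

/-- Only the last letter of the word touches `y`, so merging occurs at the end of the induction;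
earlier letters are simply prepended. -/
theorem IsOffPair.startsLetter_word_mul (h : IsOffPair τ A B i j u v) {y : H →L[ℂ] H}
    (hy : y = 1 ∨ StartsPow τ A i u y ∨ StartsPow τ A j (star v) y) {o : Option ι}
    {b : H →L[ℂ] H} (hb : AltFrom τ (fun k => (B k : Set (H →L[ℂ] H))) o b) :
    ∀ k, o = some k → StartsLetter τ A i j u v k (b * y) := by
  induction hb with
  | one => simp
  | @mul k b o r hb h0 ho hr ih =>
    rintro _ ⟨⟩
    rw [mul_assoc]
    cases o with
    | none =>
      rw [hr.eq_one, one_mul]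
      rcases hy with rfl | hy | hy
      · exact ⟨b, none, 1, h.isLetter hb h0, by simp, AltFrom.one, rfl⟩
      · exact h.startsLetter_mul_pow hb h0 hy
      · exact startsLetter_swap.1 (h.swap.startsLetter_mul_pow hb h0 hy)
    | some m => exact ⟨b, some m, r * y, h.isLetter hb h0, ho, (ih m rfl).altFrom, rfl⟩

/-- The only possible collision is between `v` and a first letter in `A j`; `IsLetter` was designed
so that their product stays centred. -/
theorem IsOffPair.startsPow_mul (h : IsOffPair τ A B i j u v) {y : H →L[ℂ] H}
    (hy : y = 1 ∨ (∃ k, StartsLetter τ A i j u v k y) ∨ StartsPow τ A i u y) :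
    StartsPow τ A i u (u * v * y) := by
  have hji : some j ≠ some i := by simpa using h.ne.symm
  have hij : some i ≠ some j := by simpa using h.ne
  rcases hy with rfl | ⟨k, hy⟩ | hy
  · exact ⟨some j, v * 1, hji, AltFrom.mul h.mem_right h.trace_right_eq_zero (by simp)
      AltFrom.one, mul_assoc _ _ _⟩
  · by_cases hk : k = j
    · subst hk
      obtain ⟨c, o, r, hc, ho, hr, rfl⟩ := hy
      exact ⟨some k, (v * c) * r, hji, AltFrom.mul (mul_mem h.mem_right hc.mem)
        (hc.trace_right rfl) ho hr, by simp only [mul_assoc]⟩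
    · exact ⟨some j, v * y, hji, AltFrom.mul h.mem_right h.trace_right_eq_zero
        (by simpa using hk) hy.altFrom, mul_assoc _ _ _⟩
  · exact ⟨some j, v * y, hji, AltFrom.mul h.mem_right h.trace_right_eq_zero hij
      (h.altFrom_of_startsPow hy), mul_assoc _ _ _⟩

theorem IsOffPair.startsPow_pow_mul (h : IsOffPair τ A B i j u v) {y : H →L[ℂ] H}
    (hy : y = 1 ∨ ∃ k, StartsLetter τ A i j u v k y) {n : ℕ} (hn : n ≠ 0) :
    StartsPow τ A i u ((u * v) ^ n * y) := by
  induction n with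
  | zero => exact absurd rfl hn
  | succ n ih =>
    rcases eq_or_ne n 0 with rfl | hn'
    · rw [zero_add, pow_one]
      exact h.startsPow_mul (hy.imp_right Or.inl)
    · rw [pow_succ', mul_assoc]
      exact h.startsPow_mul (Or.inr (Or.inr (ih hn')))

theorem IsOffPair.startsPow_star_pow_mul (h : IsOffPair τ A B i j u v) {y : H →L[ℂ] H}
    (hy : y = 1 ∨ ∃ k, StartsLetter τ A i j u v k y) {n : ℕ} (hn : n ≠ 0) :
    StartsPow τ A j (star v) (star (u * v) ^ n * y) := by
  rw [star_mul]
  exact h.swap.startsPow_pow_mul (by simpa only [startsLetter_swap] using hy) hn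

theorem IsOffPair.trace_pow (h : IsOffPair τ A B i j u v)
    (hF : FreeFamily τ fun k => (A k : Set (H →L[ℂ] H))) {n : ℕ} (hn : n ≠ 0) :
    τ ((u * v) ^ n) = 0 := by
  simpa using hF.trace_eq_zero (h.altFrom_of_startsPow (h.startsPow_pow_mul (Or.inl rfl) hn))

theorem IsOffPair.trace_star_pow (h : IsOffPair τ A B i j u v)
    (hF : FreeFamily τ fun k => (A k : Set (H →L[ℂ] H))) {n : ℕ} (hn : n ≠ 0) :
    τ (star (u * v) ^ n) = 0 := by
  rw [star_mul]
  exact h.swap.trace_pow hF hn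

/-- In a free family of abelian algebras, the product of two unitaries from different algebras
with zero expectation on subalgebras `B k` is free from the algebra generated by the `B k`. -/
theorem IsOffPair.freelyIndependent (h : IsOffPair τ A B i j u v) {M : VonNeumannAlgebra H}
    (hτ : NormalOn (M : Set (H →L[ℂ] H)) τ) (h1 : τ 1 = 1) (hA : ∀ k, A k ≤ M)
    (hF : FreeFamily τ fun k => (A k : Set (H →L[ℂ] H))) :
    FreelyIndependent τ (vnGen {u * v}) (vnGen (⋃ k, (B k : Set (H →L[ℂ] H)))) := by
  have hUM : u * v ∈ M := mul_mem (hA _ h.mem_left) (hA _ h.mem_right)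
  have hU : u * v ∈ unitary (H →L[ℂ] H) := mul_mem h.unitary_left h.unitary_right
  have hBM : ∀ k, B k ≤ M := fun k => (h.le k).trans (hA k)
  have hBF : FreeFamily τ fun k => (B k : Set (H →L[ℂ] H)) := fun l hl hch hp =>
    hF l hl hch fun p hpl => ⟨h.le _ (hp p hpl).1, (hp p hpl).2⟩
  set P : Set (H →L[ℂ] H) := {x | ∃ n : ℕ, n ≠ 0 ∧ (x = (u * v) ^ n ∨ x = star (u * v) ^ n)}
  set W : Set (H →L[ℂ] H) := {y | ∃ k, AltFrom τ (fun k => (B k : Set (H →L[ℂ] H))) (some k) y}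
  -- The three forms of the first block (nothing, a power, a `B`-word) are the invariant carried
  -- along as blocks are added on the left; each is an alternating centred word in the `A k` or the
  -- empty word.
  have words : ∀ o y, AltFrom τ (fun t : Bool => if t then P else W) o y →
      (o = none → y = 1) ∧
      (o = some true → StartsPow τ A i u y ∨ StartsPow τ A j (star v) y) ∧
      (o = some false → ∃ k, StartsLetter τ A i j u v k y) := by
    intro o y hy
    induction hy with
    | one => simp
    | @mul t c o r hc _ ho _ ih =>
      cases t with
      | true =>
        have hr : r = 1 ∨ ∃ k, StartsLetter τ A i j u v k r := by
          rcases o with _ | _ | _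
          · exact Or.inl (ih.1 rfl)
          · exact Or.inr (ih.2.2 rfl)
          · exact absurd rfl ho
        obtain ⟨n, hn, rfl | rfl⟩ : c ∈ P := by simpa using hc
        · exact ⟨by simp, fun _ => Or.inl (h.startsPow_pow_mul hr hn), by simp⟩
        · exact ⟨by simp, fun _ => Or.inr (h.startsPow_star_pow_mul hr hn), by simp⟩
      | false =>
        have hr : r = 1 ∨ StartsPow τ A i u r ∨ StartsPow τ A j (star v) r := by
          rcases o with _ | _ | _
          · exact Or.inl (ih.1 rfl)
          · exact absurd rfl ho
          · exact Or.inr (ih.2.1 rfl)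
        obtain ⟨k, hk⟩ : c ∈ W := by simpa using hc
        exact ⟨by simp, by simp, fun _ => ⟨k, h.startsLetter_word_mul hr hk k rfl⟩⟩
  have hPM : P ⊆ M := by
    rintro _ ⟨n, -, rfl | rfl⟩
    · exact pow_mem hUM n
    · exact pow_mem (star_mem hUM) n
  have hWM : W ⊆ M := by
    rintro y ⟨k, hk⟩
    exact hk.mem hBM
  have hVM : vnGen {u * v} ≤ M := vnGen_le (Set.singleton_subset_iff.2 hUM)
  have hBM' : vnGen (⋃ k, (B k : Set (H →L[ℂ] H))) ≤ M := vnGen_le (Set.iUnion_subset hBM)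
  have key := freeFamily_of_dense (M := M) (τ := τ) (G := fun t : Bool => if t then P else W)
    (A := fun t : Bool => ((if t then vnGen {u * v} else
      vnGen (⋃ k, (B k : Set (H →L[ℂ] H))) : VonNeumannAlgebra H) : Set (H →L[ℂ] H)))
    hτ h1 (by rintro (_ | _); exacts [hWM, hPM]) (by rintro (_ | _); exacts [hBM', hVM])
    (by rintro (_ | _); exacts [normalDense_altFrom h1 hBM, normalDense_powers hU hUM])
    (by
      rintro (_ | _)
      · rintro y ⟨k, hk⟩
        exact hBF.trace_eq_zero hk
      · rintro _ ⟨n, hn, rfl | rfl⟩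
        exacts [h.trace_pow hF hn, h.trace_star_pow hF hn])
    (by
      rintro (_ | _) y hy
      · obtain ⟨k, hk⟩ := (words _ _ hy).2.2 rfl
        exact hF.trace_eq_zero hk.altFrom
      · rcases (words _ _ hy).2.1 rfl with hk | hk
        · exact hF.trace_eq_zero (h.altFrom_of_startsPow hk)
        · exact hF.trace_eq_zero (h.swap.altFrom_of_startsPow hk))
  -- `FreelyIndependent` unfolds to `FreeFamily` indexed by `Bool`.
  exact key

theorem FreelyIndependent.mono_right {A' B' C' : VonNeumannAlgebra H}
    (h : FreelyIndependent τ A' B') (hC : C' ≤ B') : FreelyIndependent τ A' C' := by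
  intro l hl hch hp
  refine h l hl hch fun p hpl => ⟨?_, (hp p hpl).2⟩
  have := (hp p hpl).1
  rcases p with ⟨_ | _, x⟩
  · exact hC this
  · exact this

/-- Functionals of the form `∑ₖ ⟪ξₖ, x ξₖ⟫` are hermitian. -/
theorem trace_star_of_hasSum {M : VonNeumannAlgebra H} {ξ : ℕ → H}
    (h : ∀ x ∈ M, HasSum (fun k => inner ℂ (ξ k) (x (ξ k))) (τ x)) {x : H →L[ℂ] H} (hx : x ∈ M) :
    τ (star x) = star (τ x) := by
  have h1 := h (star x) (star_mem hx)
  have h2 := (h x hx).star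
  refine h1.unique ?_
  convert h2 using 2 with k
  rw [ContinuousLinearMap.star_eq_adjoint, ContinuousLinearMap.adjoint_inner_right,
    RCLike.star_def, inner_conj_symm]

/-- A unitary with zero expectation on `B`, in an abelian algebra: its adjoint has zero
expectation as well. -/
theorem trace_star_mul_eq_zero {M A' B' : VonNeumannAlgebra H}
    (hstar : ∀ x ∈ M, τ (star x) = star (τ x)) (hAM : A' ≤ M) (hBA : B' ≤ A')
    (hA : IsAbelianVNA A') (hu : u ∈ A') (h0 : ∀ b ∈ B', τ (u * b) = 0) :
    ∀ b ∈ B', τ (star u * b) = 0 := by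
  intro b hb
  have h1 : star u * b = star (u * star b) := by
    rw [star_mul, star_star]
    exact hA _ (star_mem hu) _ (hBA hb)
  rw [h1, hstar _ (hAM (mul_mem hu (star_mem (hBA hb)))), h0 _ (star_mem hb), star_zero]

theorem IsCondExp.trace_mul_eq_zero {B' : VonNeumannAlgebra H} (h : IsCondExp τ B' u 0) :
    ∀ b ∈ B', τ (u * b) = 0 := fun b hb => by
  simpa using (h.2 b hb).symm

theorem IsOffPair.of_isCondExp {M : VonNeumannAlgebra H}
    (hstar : ∀ x ∈ M, τ (star x) = star (τ x)) (hA : ∀ k, A k ≤ M) (hBA : ∀ k, B k ≤ A k)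
    (hab : ∀ k, IsAbelianVNA (A k)) (hij : i ≠ j) (hu : u ∈ A i) (hv : v ∈ A j)
    (huu : u ∈ unitary (H →L[ℂ] H)) (hvu : v ∈ unitary (H →L[ℂ] H))
    (hEu : IsCondExp τ (B i) u 0) (hEv : IsCondExp τ (B j) v 0) : IsOffPair τ A B i j u v where
  ne := hij
  le := hBA
  comm := hab
  mem_left := hu
  mem_right := hv
  unitary_left := huu
  unitary_right := hvu
  trace_left := hEu.trace_mul_eq_zero
  trace_star_left :=
    trace_star_mul_eq_zero hstar (hA i) (hBA i) (hab i) hu hEu.trace_mul_eq_zero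
  trace_right := hEv.trace_mul_eq_zero
  trace_star_right :=
    trace_star_mul_eq_zero hstar (hA j) (hBA j) (hab j) hv hEv.trace_mul_eq_zero

/-- In the tracial free product of two abelian algebras, the product of unitaries with zero
expectation on `B₁` and `B₂` is free from `B₁ * B₂`. -/
theorem IsFreeProduct.elementFreeFrom {M A₁ A₂ B₁ B₂ : VonNeumannAlgebra H}
    {u₁ u₂ : H →L[ℂ] H} (h : IsFreeProduct M τ A₁ A₂) (hA₁ : IsAbelianVNA A₁)
    (hA₂ : IsAbelianVNA A₂) (hB₁ : B₁ ≤ A₁) (hB₂ : B₂ ≤ A₂) (hu₁ : u₁ ∈ A₁) (hu₂ : u₂ ∈ A₂)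
    (hu₁' : u₁ ∈ unitary (H →L[ℂ] H)) (hu₂' : u₂ ∈ unitary (H →L[ℂ] H))
    (hE₁ : IsCondExp τ B₁ u₁ 0) (hE₂ : IsCondExp τ B₂ u₂ 0) :
    ElementFreeFrom τ (u₁ * u₂)
      (vnGen ((B₁ : Set (H →L[ℂ] H)) ∪ (B₂ : Set (H →L[ℂ] H)))) := by
  obtain ⟨ξ, -, hξ⟩ := h.tracialVNA.normal
  have hle : ((A₁ : Set (H →L[ℂ] H)) ∪ A₂) ⊆ M := by
    have := subset_vnGen ((A₁ : Set (H →L[ℂ] H)) ∪ A₂)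
    rwa [h.generates] at this
  have hAM : ∀ t : Bool, (if t then A₁ else A₂) ≤ M := by
    rintro (_ | _)
    exacts [fun x hx => hle (Or.inr hx), fun x hx => hle (Or.inl hx)]
  have hpair : IsOffPair τ (fun t : Bool => if t then A₁ else A₂)
      (fun t : Bool => if t then B₁ else B₂) true false u₁ u₂ :=
    IsOffPair.of_isCondExp (M := M) (fun x hx => trace_star_of_hasSum hξ hx) hAM
      (by rintro (_ | _); exacts [hB₂, hB₁]) (by rintro (_ | _); exacts [hA₂, hA₁]) (by simp)
      hu₁ hu₂ hu₁' hu₂' hE₁ hE₂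
  refine (hpair.freelyIndependent h.tracialVNA.normalOn h.tracialVNA.unital hAM
    h.free).mono_right (vnGen_le ?_)
  refine Set.union_subset (fun x hx => ?_) (fun x hx => ?_)
  · exact subset_vnGen _ (Set.mem_iUnion.2 ⟨true, hx⟩)
  · exact subset_vnGen _ (Set.mem_iUnion.2 ⟨false, hx⟩)

end FreeProducts

/-! ### Commutativity of singly generated algebras. -/

section Abelian

variable {H : Type*} [NormedAddCommGroup H] [InnerProductSpace ℂ H] [CompleteSpace H]

/-- A normal operator generates an abelian von Neumann algebra. -/
theorem isAbelianVNA_vnGen_singleton {w : H →L[ℂ] H} (hw : Commute w (star w)) :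
    IsAbelianVNA (vnGen {w}) := by
  have hT : ({w} ∪ star {w} : Set (H →L[ℂ] H)) ⊆ Set.centralizer ({w} ∪ star {w}) := by
    intro x hx y hy
    have h : ∀ z ∈ ({w} ∪ star {w} : Set (H →L[ℂ] H)), z = w ∨ z = star w := by
      rintro z (hz | hz)
      · exact Or.inl hz
      · exact Or.inr (star_eq_iff_star_eq.1 hz).symm
    rcases h x hx with rfl | rfl <;> rcases h y hy with rfl | rfl
    exacts [rfl, hw.symm.eq, hw.eq, rfl]
  -- With T = {w, w*} one has T ⊆ T′, hence T″ ⊆ T′, and elements of T″ commute with those of T′.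
  intro x hx y hy
  rw [← SetLike.mem_coe, coe_vnGen] at hx hy
  exact hy _ (Set.centralizer_subset hT hx)

end Abelian

/-! ### The regular representation: trace, separating vector, fixed vectors. -/

section GroupVNA

variable {G : Type*} [Group G]

theorem deltaOne_apply [DecidableEq G] (h : G) : deltaOne G h = if h = 1 then 1 else 0 := by
  obtain rfl : ‹DecidableEq G› = Classical.decEq G := Subsingleton.elim _ _
  let _ := Classical.decEq G
  rw [deltaOne, lp.single_apply]
  by_cases hh : h = 1
  · subst hh; simp
  · simp [hh]

theorem inner_deltaOne (ξ : ellTwo G) : inner ℂ (deltaOne G) ξ = ξ 1 := by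
  rw [deltaOne]
  simp [lp.inner_single_left]

theorem canonicalTrace_apply (x : ellTwo G →L[ℂ] ellTwo G) :
    canonicalTrace G x = x (deltaOne G) 1 :=
  inner_deltaOne _

theorem leftReg_one : leftReg (1 : G) = 1 := by
  ext ξ h
  simp [leftReg_apply]

theorem leftReg_mul (g h : G) : leftReg (g * h) = leftReg g * leftReg h := by
  ext ξ k
  simp [leftReg_apply, mul_assoc]

theorem star_leftReg (g : G) : star (leftReg g) = leftReg g⁻¹ := by
  rw [ContinuousLinearMap.star_eq_adjoint, eq_comm, ContinuousLinearMap.eq_adjoint_iff]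
  intro ξ η
  rw [lp.inner_eq_tsum, lp.inner_eq_tsum, ← (Equiv.mulLeft g⁻¹).tsum_eq]
  simp [leftReg_apply]

theorem leftReg_mem_unitary (g : G) : leftReg g ∈ unitary (ellTwo G →L[ℂ] ellTwo G) := by
  rw [Unitary.mem_iff, star_leftReg, ← leftReg_mul, ← leftReg_mul]
  simp [leftReg_one]

theorem leftReg_pow (g : G) (n : ℕ) : leftReg g ^ n = leftReg (g ^ n) := by
  induction n with
  | zero => simp [leftReg_one]
  | succ n ih => rw [pow_succ, pow_succ, ih, leftReg_mul]

theorem canonicalTrace_leftReg [DecidableEq G] (g : G) :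
    canonicalTrace G (leftReg g) = if g = 1 then 1 else 0 := by
  rw [canonicalTrace_apply, leftReg_apply, deltaOne_apply]
  simp

theorem canonicalTrace_one : canonicalTrace G 1 = 1 := by
  classical
  rw [← leftReg_one, canonicalTrace_leftReg]
  simp

theorem canonicalTrace_normalOn (M : Set (ellTwo G →L[ℂ] ellTwo G)) :
    NormalOn M (canonicalTrace G) := by
  refine ⟨Unit, fun _ => deltaOne G, fun _ => deltaOne G, (hasSum_fintype _).summable,
    (hasSum_fintype _).summable, fun x _ => ?_⟩
  convert hasSum_fintype (fun _ : Unit => inner ℂ (deltaOne G) (x (deltaOne G))) using 1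
  simp [canonicalTrace]

theorem canonicalTrace_star (x : ellTwo G →L[ℂ] ellTwo G) :
    canonicalTrace G (star x) = star (canonicalTrace G x) := by
  change inner ℂ (deltaOne G) (star x (deltaOne G)) = star (inner ℂ (deltaOne G) (x (deltaOne G)))
  rw [ContinuousLinearMap.star_eq_adjoint, ContinuousLinearMap.adjoint_inner_right,
    RCLike.star_def, inner_conj_symm]

theorem leftReg_mem_groupVNA (g : G) : leftReg g ∈ groupVNA G :=
  subset_vnGen _ ⟨g, rfl⟩

/-- The right translation `(ρ_g ξ)(h) = ξ(h g)`. -/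
noncomputable def rightTranslation (g : G) : ellTwo G →ₗᵢ[ℂ] ellTwo G where
  toFun ξ := ⟨fun h => ξ (h * g), by
    have h2 : 0 < (2 : ℝ≥0∞).toReal := by norm_num
    refine memℓp_gen ?_
    exact ((Equiv.mulRight g).summable_iff
      (f := fun h => ‖ξ h‖ ^ (2 : ℝ≥0∞).toReal)).2 ((lp.memℓp ξ).summable h2)⟩
  map_add' ξ η := by ext h; rfl
  map_smul' c ξ := by ext h; rfl
  norm_map' ξ := by
    have h2 : 0 < (2 : ℝ≥0∞).toReal := by norm_num
    rw [lp.norm_eq_tsum_rpow h2, lp.norm_eq_tsum_rpow h2]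
    congr 1
    exact (Equiv.mulRight g).tsum_eq (fun h => ‖ξ h‖ ^ (2 : ℝ≥0∞).toReal)

theorem rightTranslation_apply (g : G) (ξ : ellTwo G) (h : G) :
    rightTranslation g ξ h = ξ (h * g) := rfl

/-- Left and right translations commute by associativity, so right translations lie in the commutant
of L(G). -/
theorem groupVNA_comm_rightTranslation {x : ellTwo G →L[ℂ] ellTwo G} (hx : x ∈ groupVNA G)
    (g : G) (ξ : ellTwo G) : x (rightTranslation g ξ) = rightTranslation g (x ξ) := by
  rw [← SetLike.mem_coe, groupVNA, coe_vnGen] at hx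
  have hρ : (rightTranslation g).toContinuousLinearMap ∈ Set.centralizer
      (Set.range (leftReg (G := G)) ∪ star (Set.range (leftReg (G := G)))) := by
    have hl : ∀ h : G, leftReg h * (rightTranslation g).toContinuousLinearMap =
        (rightTranslation g).toContinuousLinearMap * leftReg h := by
      intro h
      ext ξ k
      simp [leftReg_apply, rightTranslation_apply, mul_assoc]
    rintro y (⟨h, rfl⟩ | ⟨h, hy⟩)
    · exact hl h
    · rw [← star_eq_iff_star_eq.1 hy.symm, star_leftReg]
      exact hl _
  exact (congrArg (fun T : ellTwo G →L[ℂ] ellTwo G => T ξ) (hx _ hρ)).symm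

/-- The vector `δ_e` is separating for `L(G)`. -/
theorem eq_zero_of_apply_deltaOne {x : ellTwo G →L[ℂ] ellTwo G} (hx : x ∈ groupVNA G)
    (h0 : x (deltaOne G) = 0) : x = 0 := by
  classical
  refine lp.ext_continuousLinearMap (by norm_num) fun g => ?_
  ext1
  have hs : lp.single 2 g (1 : ℂ) = rightTranslation g⁻¹ (deltaOne G) := by
    ext h
    rw [rightTranslation_apply, deltaOne_apply, lp.single_apply]
    by_cases hh : h = g
    · subst hh; simp
    · simp [hh, mul_inv_eq_one]
  change x (lp.single 2 g 1) = 0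
  rw [hs, groupVNA_comm_rightTranslation hx, h0, map_zero]

/-- The canonical trace is faithful on `L(G)`. -/
theorem eq_zero_of_canonicalTrace_mul_star {x : ellTwo G →L[ℂ] ellTwo G} (hx : x ∈ groupVNA G)
    (h0 : canonicalTrace G (x * star x) = 0) : x = 0 := by
  rw [← star_eq_zero]
  refine eq_zero_of_apply_deltaOne (star_mem hx) ?_
  rw [← inner_self_eq_zero (𝕜 := ℂ)]
  nth_rw 1 [ContinuousLinearMap.star_eq_adjoint]
  rw [ContinuousLinearMap.adjoint_inner_left]
  exact h0

/-- If `g` has infinite order, no nonzero vector is fixed by `λ_g`. -/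
theorem eq_zero_of_leftReg_apply_eq {g : G} (hg : ∀ m : ℕ, m ≠ 0 → g ^ m ≠ 1) {ξ : ellTwo G}
    (hξ : leftReg g ξ = ξ) : ξ = 0 := by
  ext h
  have hinv : ∀ m : ℕ, ξ (g ^ m * h) = ξ h := by
    intro m
    induction m with
    | zero => simp
    | succ m ih =>
      have := congrArg (fun η : ellTwo G => η (g * (g ^ m * h))) hξ
      simp only [leftReg_apply, inv_mul_cancel_left] at this
      rw [pow_succ', mul_assoc, ← this, ih]
  have hinj : Function.Injective fun m : ℕ => g ^ m * h := by
    intro m n hmn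
    have hmn : g ^ m = g ^ n := mul_right_cancel hmn
    rcases lt_trichotomy m n with hlt | heq | hlt
    · refine absurd ?_ (hg (n - m) (Nat.sub_ne_zero_of_lt hlt))
      rw [pow_sub g hlt.le, hmn, mul_inv_cancel]
    · exact heq
    · refine absurd ?_ (hg (m - n) (Nat.sub_ne_zero_of_lt hlt))
      rw [pow_sub g hlt.le, hmn, mul_inv_cancel]
  have h2 : 0 < (2 : ℝ≥0∞).toReal := by norm_num
  -- `ξ` is constant along the infinite orbit of `h`, and a summable constant family on an infinite
  -- set is zero.
  have hs := ((lp.memℓp ξ).summable h2).comp_injective hinj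
  simp only [Function.comp_def, hinv] at hs
  have := (summable_const_iff _).1 hs
  simpa using (Real.rpow_eq_zero (norm_nonneg _) h2.ne').1 this

end GroupVNA

/-! ### Freeness of the `genAlg i`, and the Haar and freeness statements. -/

section FreeGroupFactor

variable {n : ℕ}

theorem genUnitary_mem_unitary (i : Fin n) : genUnitary i ∈
    unitary (ellTwo (FreeGroup (Fin n)) →L[ℂ] ellTwo (FreeGroup (Fin n))) :=
  leftReg_mem_unitary _

theorem genUnitary_mem_genAlg (i : Fin n) : genUnitary i ∈ genAlg i :=
  subset_vnGen _ rfl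

theorem genAlg_le (i : Fin n) : genAlg i ≤ groupVNA (FreeGroup (Fin n)) :=
  vnGen_le (Set.singleton_subset_iff.2 (leftReg_mem_groupVNA _))

theorem evenAlg_le (i : Fin n) : evenAlg i ≤ genAlg i :=
  vnGen_le (Set.singleton_subset_iff.2
    (add_mem (genUnitary_mem_genAlg i) (star_mem (genUnitary_mem_genAlg i))))

theorem genAlg_isAbelian (i : Fin n) : IsAbelianVNA (genAlg i) := by
  refine isAbelianVNA_vnGen_singleton ?_
  have h := genUnitary_mem_unitary i
  rw [Commute, SemiconjBy, Unitary.mul_star_self_of_mem h, Unitary.star_mul_self_of_mem h]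

/-- Each summand of the radial generator belongs to one of the `evenAlg i`; freeness from `radialAlg
n` is inherited from the larger algebra. -/
theorem radialAlg_le (n : ℕ) :
    radialAlg n ≤ vnGen (⋃ i : Fin n, (evenAlg i : Set (_ →L[ℂ] _))) := by
  refine vnGen_le (Set.singleton_subset_iff.2 ?_)
  refine sum_mem fun i _ => subset_vnGen _ (Set.mem_iUnion.2 ⟨i, subset_vnGen _ rfl⟩)

theorem leftReg_zpow_mem_genAlg (i : Fin n) (k : ℤ) :
    leftReg (FreeGroup.of i ^ k) ∈ genAlg i := by
  obtain ⟨m, rfl | rfl⟩ := k.eq_nat_or_neg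
  · rw [zpow_natCast, ← leftReg_pow]
    exact pow_mem (genUnitary_mem_genAlg i) m
  · rw [zpow_neg, zpow_natCast, ← star_leftReg, ← leftReg_pow]
    exact star_mem (pow_mem (genUnitary_mem_genAlg i) m)

/-- The nonzero powers of the generating unitary `w_i`. -/
def genPowers (i : Fin n) :
    Set (ellTwo (FreeGroup (Fin n)) →L[ℂ] ellTwo (FreeGroup (Fin n))) :=
  {x | ∃ k : ℤ, k ≠ 0 ∧ x = leftReg (FreeGroup.of i ^ k)}

theorem normalDense_genPowers (i : Fin n) :
    NormalDense (groupVNA (FreeGroup (Fin n)) : Set (_ →L[ℂ] _)) (insert 1 (genPowers i))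
      (genAlg i) := by
  refine (normalDense_powers (genUnitary_mem_unitary i) (leftReg_mem_groupVNA _)).mono ?_
  refine (Set.insert_subset_insert ?_).trans Submodule.subset_span
  rintro _ ⟨m, hm, rfl | rfl⟩
  · exact ⟨m, by exact_mod_cast hm, by rw [zpow_natCast, ← leftReg_pow]; rfl⟩
  · refine ⟨-m, by simpa using hm, ?_⟩
    rw [zpow_neg, zpow_natCast, ← star_leftReg, ← leftReg_pow, star_pow]
    rfl

/-- The exponent-sum homomorphism to ℤ detects the power. -/
theorem freeGroup_of_zpow_eq_one {i : Fin n} {k : ℤ} (h : FreeGroup.of i ^ k = 1) : k = 0 := by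
  have := congrArg (FreeGroup.lift fun _ : Fin n => Multiplicative.ofAdd (1 : ℤ)) h
  simpa [← ofAdd_zsmul] using this

/-- Alternating products of nonzero generator powers are reduced words of F_n viewed as a free
product of copies of ℤ. Uniqueness of normal forms then shows that a nonempty one is not λ_e, so its
trace vanishes. -/
theorem exists_word_of_altFrom {τ : (ellTwo (FreeGroup (Fin n)) →L[ℂ] ellTwo (FreeGroup (Fin n)))
    →ₗ[ℂ] ℂ} {o : Option (Fin n)} {y : ellTwo (FreeGroup (Fin n)) →L[ℂ] ellTwo (FreeGroup (Fin n))}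
    (h : AltFrom τ genPowers o y) :
    ∃ w : Monoid.CoprodI.Word (fun _ : Fin n => FreeGroup Unit),
      w.fstIdx = o ∧ y = leftReg (freeGroupEquivCoprodI.symm w.prod) := by
  induction h with
  | one => exact ⟨Monoid.CoprodI.Word.empty, rfl, by simp [leftReg_one]⟩
  | @mul i c o r hc _ ho _ ih =>
    obtain ⟨w, rfl, rfl⟩ := ih
    obtain ⟨k, hk, rfl⟩ := hc
    have h1 : (FreeGroup.of () : FreeGroup Unit) ^ k ≠ 1 := by
      intro h
      have := congrArg (FreeGroup.lift fun _ : Unit => Multiplicative.ofAdd (1 : ℤ)) h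
      exact hk (by simpa [← ofAdd_zsmul] using this)
    refine ⟨Monoid.CoprodI.Word.cons _ w ho h1, by simp, ?_⟩
    rw [Monoid.CoprodI.Word.prod_cons, map_mul, leftReg_mul]
    congr 2
    simp [freeGroupEquivCoprodI]

theorem canonicalTrace_altFrom_genPowers (k : Fin n)
    {y : ellTwo (FreeGroup (Fin n)) →L[ℂ] ellTwo (FreeGroup (Fin n))}
    (h : AltFrom (canonicalTrace (FreeGroup (Fin n))) genPowers (some k) y) :
    canonicalTrace (FreeGroup (Fin n)) y = 0 := by
  classical
  obtain ⟨w, hw, rfl⟩ := exists_word_of_altFrom h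
  rw [canonicalTrace_leftReg, if_neg]
  intro h1
  rw [EmbeddingLike.map_eq_one_iff] at h1
  have : w = Monoid.CoprodI.Word.empty :=
    Monoid.CoprodI.Word.equiv.symm.injective h1
  subst this
  cases hw

/-- The algebras `A_i` are free in `L(F_n)`. -/
theorem freeFamily_genAlg : FreeFamily (canonicalTrace (FreeGroup (Fin n)))
    (fun i : Fin n => (genAlg i :
      Set (ellTwo (FreeGroup (Fin n)) →L[ℂ] ellTwo (FreeGroup (Fin n))))) := by
  classical
  refine freeFamily_of_dense (M := groupVNA _) (G := genPowers) (canonicalTrace_normalOn _)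
    canonicalTrace_one ?_ genAlg_le normalDense_genPowers ?_ ?_
  · rintro k _ ⟨m, -, rfl⟩
    exact leftReg_mem_groupVNA _
  · rintro k _ ⟨m, hm, rfl⟩
    rw [canonicalTrace_leftReg, if_neg fun h => hm (freeGroup_of_zpow_eq_one h)]
  · exact fun k y => canonicalTrace_altFrom_genPowers k

/-- Products of unitaries of `A_i` and `A_j` with zero expectation on `B_i` and `B_j`. -/
theorem isHaarUnitary_and_elementFreeFrom {i j : Fin n} (hij : i ≠ j)
    {u v : ellTwo (FreeGroup (Fin n)) →L[ℂ] ellTwo (FreeGroup (Fin n))}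
    (hu : u ∈ genAlg i) (hv : v ∈ genAlg j) (huu : u ∈ unitary (_ →L[ℂ] _))
    (hvu : v ∈ unitary (_ →L[ℂ] _))
    (hEu : IsCondExp (canonicalTrace (FreeGroup (Fin n))) (evenAlg i) u 0)
    (hEv : IsCondExp (canonicalTrace (FreeGroup (Fin n))) (evenAlg j) v 0) :
    IsHaarUnitary (groupVNA (FreeGroup (Fin n))) (canonicalTrace (FreeGroup (Fin n))) (u * v) ∧
      ElementFreeFrom (canonicalTrace (FreeGroup (Fin n))) (u * v) (radialAlg n) := by
  have h : IsOffPair (canonicalTrace (FreeGroup (Fin n))) genAlg evenAlg i j u v :=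
    IsOffPair.of_isCondExp (M := groupVNA _) (fun x _ => canonicalTrace_star x) genAlg_le
      evenAlg_le genAlg_isAbelian hij hu hv huu hvu hEu hEv
  refine ⟨⟨mul_mem (genAlg_le i hu) (genAlg_le j hv), mul_mem huu hvu, fun k hk =>
    ⟨h.trace_pow freeFamily_genAlg hk, h.trace_star_pow freeFamily_genAlg hk⟩⟩, ?_⟩
  exact (h.freelyIndependent (M := groupVNA _) (canonicalTrace_normalOn _) canonicalTrace_one
    genAlg_le freeFamily_genAlg).mono_right (radialAlg_le n)

end FreeGroupFactor

/-! ### Weak operator limits along ultrafilters. -/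

section WeakLimits

open Filter Topology

variable {H : Type*} [NormedAddCommGroup H] [InnerProductSpace ℂ H] [CompleteSpace H]

/-- Bounded sequences of operators have weak limits along ultrafilters. -/
theorem exists_weakLimit {T : ℕ → H →L[ℂ] H} {C : ℝ} (hT : ∀ N, ‖T N‖ ≤ C) (F : Ultrafilter ℕ) :
    ∃ S : H →L[ℂ] H, ∀ ξ η,
      Tendsto (fun N => inner ℂ ξ (T N η)) F (𝓝 (inner ℂ ξ (S η))) := by
  have hbound : ∀ v w N, ‖inner ℂ (T N v) w‖ ≤ C * ‖v‖ * ‖w‖ := fun v w N =>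
    (norm_inner_le_norm _ _).trans (mul_le_mul_of_nonneg_right
      (((T N).le_opNorm v).trans (mul_le_mul_of_nonneg_right (hT N) (norm_nonneg _)))
      (norm_nonneg _))
  -- Compactness of discs gives the limit of each matrix coefficient; the limits form a bounded
  -- sesquilinear form, represented by an operator.
  have hex : ∀ v w, ∃ b ∈ Metric.closedBall (0 : ℂ) (C * ‖v‖ * ‖w‖),
      Tendsto (fun N => inner ℂ (T N v) w) F (𝓝 b) := by
    intro v w
    have := (isCompact_closedBall (0 : ℂ) (C * ‖v‖ * ‖w‖)).ultrafilter_le_nhds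
      (F.map fun N => inner ℂ (T N v) w)
      (le_principal_iff.2 (Ultrafilter.mem_map.2 (Filter.univ_mem' fun N => by
        simpa using hbound v w N)))
    exact this
  choose b hbC hb using hex
  have hF : (F : Filter ℕ).NeBot := F.neBot
  let B₀ : H →ₗ⋆[ℂ] H →ₗ[ℂ] ℂ := LinearMap.mk₂'ₛₗ (starRingEnd ℂ) (RingHom.id ℂ) b
    (fun v v' w => tendsto_nhds_unique (hb _ _) (by
      simpa [inner_add_left] using (hb v w).add (hb v' w)))
    (fun c v w => tendsto_nhds_unique (hb _ _) (by
      simpa [inner_smul_left, mul_comm] using (hb v w).const_mul (starRingEnd ℂ c)))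
    (fun v w w' => tendsto_nhds_unique (hb _ _) (by
      simpa [inner_add_right] using (hb v w).add (hb v w')))
    (fun c v w => tendsto_nhds_unique (hb _ _) (by
      simpa [inner_smul_right] using (hb v w).const_mul c))
  let B : H →L⋆[ℂ] H →L[ℂ] ℂ := B₀.mkContinuous₂ C
    (fun v w => by simpa [B₀] using hbC v w)
  refine ⟨InnerProductSpace.continuousLinearMapOfBilin B, fun ξ η => ?_⟩
  have h1 : inner ℂ (InnerProductSpace.continuousLinearMapOfBilin B η) ξ = b η ξ :=
    InnerProductSpace.continuousLinearMapOfBilin_apply B η ξ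
  have h2 := (hb η ξ).star
  rw [← h1] at h2
  simpa only [RCLike.star_def, inner_conj_symm] using h2

theorem ext_of_inner {S T : H →L[ℂ] H} (h : ∀ ξ η, inner ℂ ξ (S η) = inner ℂ ξ (T η)) :
    S = T := by
  ext η
  exact ext_inner_left ℂ fun ξ => h ξ η

/-- Weak limits of elements of a von Neumann algebra belong to it. -/
theorem mem_of_weakLimit {M : VonNeumannAlgebra H} {T : ℕ → H →L[ℂ] H} (hT : ∀ N, T N ∈ M)
    {F : Filter ℕ} [F.NeBot] {S : H →L[ℂ] H}
    (hS : ∀ ξ η, Tendsto (fun N => inner ℂ ξ (T N η)) F (𝓝 (inner ℂ ξ (S η)))) : S ∈ M := by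
  rw [← SetLike.mem_coe, ← M.centralizer_centralizer]
  intro y hy
  refine ext_of_inner fun ξ η => ?_
  refine tendsto_nhds_unique (f := fun N => inner ℂ ξ ((y * T N) η)) (l := F) ?_ ?_
  · have := hS (ContinuousLinearMap.adjoint y ξ) η
    simpa [ContinuousLinearMap.adjoint_inner_left] using this
  · have := hS ξ (y η)
    refine this.congr fun N => ?_
    rw [← hy (T N) (hT N)]
    rfl

theorem isSelfAdjoint_of_weakLimit {T : ℕ → H →L[ℂ] H} (hT : ∀ N, star (T N) = T N)
    {F : Filter ℕ} [F.NeBot] {S : H →L[ℂ] H}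
    (hS : ∀ ξ η, Tendsto (fun N => inner ℂ ξ (T N η)) F (𝓝 (inner ℂ ξ (S η)))) :
    star S = S := by
  refine ext_of_inner fun ξ η => tendsto_nhds_unique ?_ (hS ξ η)
  have := (hS η ξ).star
  rw [ContinuousLinearMap.star_eq_adjoint, ContinuousLinearMap.adjoint_inner_right]
  simp only [RCLike.star_def, inner_conj_symm] at this
  refine this.congr fun N => ?_
  rw [← ContinuousLinearMap.adjoint_inner_right, ← ContinuousLinearMap.star_eq_adjoint, hT]

end WeakLimits

/-! ### Continuous functional calculus of a unitary on ℝ/2ℤ. -/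

section CircleCalculus

variable {H : Type*} [NormedAddCommGroup H] [InnerProductSpace ℂ H] [CompleteSpace H]

/-- The inverse of the parametrisation `t ↦ exp(iπt)` of the unit circle. -/
noncomputable def sphereToAddCircle : C(Metric.sphere (0 : ℂ) 1, AddCircle (2 : ℝ)) where
  toFun z := (AddCircle.homeomorphCircle (two_ne_zero)).symm
    ⟨z, z.2⟩
  continuous_toFun := by
    refine (Homeomorph.continuous _).comp ?_
    exact Continuous.subtype_mk continuous_subtype_val _

/-- The functional calculus of a unitary `w`, for functions of the angle: the homomorphism
sending `t ↦ exp(iπt)` to `w`. -/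
noncomputable def circleHom {w : H →L[ℂ] H} (hw : w ∈ unitary (H →L[ℂ] H)) :
    C(AddCircle (2 : ℝ), ℂ) →⋆ₐ[ℂ] (H →L[ℂ] H) :=
  (cfcHomSuperset (R := ℂ) (A := H →L[ℂ] H) (p := IsStarNormal) (a := w)
    ⟨by rw [Commute, SemiconjBy, Unitary.mul_star_self_of_mem hw,
      Unitary.star_mul_self_of_mem hw]⟩
    (spectrum.subset_circle_of_unitary hw)).comp
    (ContinuousMap.compStarAlgHom' ℂ ℂ sphereToAddCircle)

theorem continuous_circleHom {w : H →L[ℂ] H} (hw : w ∈ unitary (H →L[ℂ] H)) :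
    Continuous (circleHom hw) :=
  (cfcHomSuperset_continuous _ _).comp (ContinuousMap.continuous_precomp _)

theorem circleHom_fourier_one {w : H →L[ℂ] H} (hw : w ∈ unitary (H →L[ℂ] H)) :
    circleHom hw (fourier 1) = w := by
  have h : ContinuousMap.compStarAlgHom' ℂ ℂ sphereToAddCircle (fourier (T := (2 : ℝ)) 1) =
      ContinuousMap.restrict (Metric.sphere (0 : ℂ) 1) (.id ℂ) := by
    ext z
    simp only [ContinuousMap.compStarAlgHom'_apply, ContinuousMap.comp_apply, fourier_one,
      ← AddCircle.homeomorphCircle_apply two_ne_zero, sphereToAddCircle, ContinuousMap.coe_mk]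
    exact congrArg (fun z : Circle => (z : ℂ)) (Homeomorph.apply_symm_apply _ _)
  rw [circleHom, StarAlgHom.comp_apply, h]
  exact cfcHomSuperset_id _ _

instance fact_zero_lt_two_real : Fact ((0 : ℝ) < 2) := ⟨two_pos⟩

theorem norm_circleHom_le {w : H →L[ℂ] H} (hw : w ∈ unitary (H →L[ℂ] H))
(f : C(AddCircle (2 : ℝ), ℂ)) : ‖circleHom hw f‖ ≤ ‖f‖ :=
  NonUnitalStarAlgHom.norm_apply_le (circleHom hw) f

end CircleCalculus

/-! ### Approximating the sign of sin πt and its Fourier coefficients. -/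

section SignFunction

open Filter Topology MeasureTheory

/-- Continuous approximations `x / (|x| + 1/(N+1))` of the sign function. -/
noncomputable def approxSign (N : ℕ) (x : ℝ) : ℝ := x / (|x| + 1 / ((N : ℝ) + 1))

theorem approxSign_den_pos (N : ℕ) (x : ℝ) : 0 < |x| + 1 / ((N : ℝ) + 1) := by positivity

theorem continuous_approxSign (N : ℕ) : Continuous (approxSign N) :=
  continuous_id.div (by fun_prop) fun x => (approxSign_den_pos N x).ne'

theorem abs_approxSign_le (N : ℕ) (x : ℝ) : |approxSign N x| ≤ 1 := by
  rw [approxSign, abs_div, abs_of_pos (approxSign_den_pos N x),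
    div_le_one (approxSign_den_pos N x)]
  exact le_add_of_nonneg_right (by positivity)

/-- After multiplication by |x| the convergence becomes uniform, although it is only pointwise for
`approxSign` itself. Norm convergence in the functional calculus depends on this. -/
theorem abs_approxSign_mul_abs_sub_le (N : ℕ) (x : ℝ) :
    |approxSign N x * |x| - x| ≤ 1 / ((N : ℝ) + 1) := by
  have h := approxSign_den_pos N x
  have he : approxSign N x * |x| - x = -(approxSign N x * (1 / ((N : ℝ) + 1))) := by
    rw [approxSign]
    field_simp
    ring
  rw [he, abs_neg, abs_mul, abs_of_pos (by positivity : 0 < 1 / ((N : ℝ) + 1))]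
  exact mul_le_of_le_one_left (by positivity) (abs_approxSign_le N x)

theorem tendsto_approxSign (x : ℝ) :
    Tendsto (fun N => approxSign N x) atTop (𝓝 (SignType.sign x : ℝ)) := by
  rcases eq_or_ne x 0 with rfl | hx
  · simp [approxSign]
  · have h1 : Tendsto (fun N : ℕ => |x| + 1 / ((N : ℝ) + 1)) atTop (𝓝 (|x| + 0)) :=
      tendsto_const_nhds.add tendsto_one_div_add_atTop_nhds_zero_nat
    have h2 := (tendsto_const_nhds (x := x)).div h1 (by simpa using hx)
    have h3 : x / (|x| + 0) = (SignType.sign x : ℝ) := by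
      rw [add_zero, div_eq_iff (abs_ne_zero.2 hx)]
      exact (sign_mul_abs x).symm
    rwa [h3] at h2

/-- The function `t ↦ sin (π t)` on the circle, post-composed with `φ`. -/
noncomputable def compSin (φ : ℝ → ℝ) (hφ : Continuous φ) : C(AddCircle (2 : ℝ), ℂ) where
  toFun t := ((φ (fourier 1 t).im : ℝ) : ℂ)
  continuous_toFun := by fun_prop

theorem compSin_apply (φ : ℝ → ℝ) (hφ : Continuous φ) (t : AddCircle (2 : ℝ)) :
    compSin φ hφ t = ((φ (fourier 1 t).im : ℝ) : ℂ) := rfl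

theorem star_compSin (φ : ℝ → ℝ) (hφ : Continuous φ) : star (compSin φ hφ) = compSin φ hφ := by
  ext t
  simp [compSin_apply]

theorem compSin_coe (φ : ℝ → ℝ) (hφ : Continuous φ) (t : ℝ) :
    compSin φ hφ (t : AddCircle (2 : ℝ)) = ((φ (Real.sin (Real.pi * t)) : ℝ) : ℂ) := by
  rw [compSin_apply, fourier_coe_apply]
  have : 2 * (Real.pi : ℂ) * Complex.I * ((1 : ℤ) : ℂ) * (t : ℂ) / ((2 : ℝ) : ℂ) =
      ((Real.pi * t : ℝ) : ℂ) * Complex.I := by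
    push_cast
    ring
  rw [this, Complex.exp_ofReal_mul_I_im]

theorem norm_compSin_approxSign_le (N : ℕ) :
    ‖compSin (approxSign N) (continuous_approxSign N)‖ ≤ 1 := by
  rw [ContinuousMap.norm_le _ zero_le_one]
  intro t
  rw [compSin_apply, Complex.norm_real]
  exact abs_approxSign_le N _

theorem tendsto_compSin_mul :
    Tendsto (fun N => compSin (approxSign N) (continuous_approxSign N) *
      compSin (fun x => |x|) continuous_abs) atTop (𝓝 (compSin (fun x => x) continuous_id)) := by
  rw [tendsto_iff_norm_sub_tendsto_zero]
  refine squeeze_zero (fun _ => norm_nonneg _) (fun N => ?_)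
    tendsto_one_div_add_atTop_nhds_zero_nat
  rw [ContinuousMap.norm_le _ (by positivity)]
  intro t
  have := abs_approxSign_mul_abs_sub_le N (fourier 1 t).im
  rw [ContinuousMap.sub_apply, ContinuousMap.mul_apply, compSin_apply, compSin_apply,
    compSin_apply, ← Complex.ofReal_mul, ← Complex.ofReal_sub, Complex.norm_real]
  exact this

theorem compSin_abs_mul_self : compSin (fun x => |x|) continuous_abs *
    compSin (fun x => |x|) continuous_abs =
      compSin (fun x => x) continuous_id * compSin (fun x => x) continuous_id := by
  ext t
  simp only [ContinuousMap.mul_apply, compSin_apply, ← Complex.ofReal_mul, abs_mul_abs_self]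

theorem fourier_sub_star : (fourier 1 - star (fourier 1) : C(AddCircle (2 : ℝ), ℂ)) =
    (2 * Complex.I) • compSin (fun x => x) continuous_id := by
  ext t
  simp only [ContinuousMap.sub_apply, ContinuousMap.star_apply, ContinuousMap.smul_apply,
    compSin_apply, smul_eq_mul, RCLike.star_def]
  rw [Complex.sub_conj]
  push_cast
  ring

/-- At `t = 0` both sides are zero by the convention for division by zero. -/
theorem sign_sin_pi_mul {t : ℝ} (h1 : -1 < t) (h2 : t < 1) :
    (SignType.sign (Real.sin (Real.pi * t)) : ℝ) = |t| / t := by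
  have hπ := Real.pi_pos
  rcases lt_trichotomy t 0 with h | rfl | h
  · have : Real.sin (Real.pi * t) < 0 :=
      Real.sin_neg_of_neg_of_neg_pi_lt (by nlinarith) (by nlinarith)
    rw [sign_neg this, abs_of_neg h, neg_div, div_self h.ne]
    simp
  · simp
  · have : 0 < Real.sin (Real.pi * t) :=
      Real.sin_pos_of_pos_of_lt_pi (by positivity) (by nlinarith)
    rw [sign_pos this, abs_of_pos h, div_self h.ne']
    simp

theorem fourier_neg_coe (k : ℤ) (t : ℝ) :
    fourier (-k) (t : AddCircle (2 : ℝ)) = Complex.exp (-(Complex.I * Real.pi * k * t)) := by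
  rw [fourier_coe_apply]
  congr 1
  push_cast
  ring

theorem fourierCoeff_eq_integral (f : AddCircle (2 : ℝ) → ℂ) (k : ℤ) :
    fourierCoeff f k = (1 / 2 : ℂ) * ∫ t in (-1 : ℝ)..1,
      f (t : AddCircle (2 : ℝ)) * Complex.exp (-(Complex.I * Real.pi * k * t)) := by
  rw [fourierCoeff_eq_intervalIntegral f k (-1), show (-1 : ℝ) + 2 = 1 by norm_num,
    Complex.real_smul]
  push_cast
  congr 1
  refine intervalIntegral.integral_congr fun t _ => ?_
  simp only [smul_eq_mul, fourier_neg_coe, mul_comm]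

/-- The Fourier coefficients of the approximations converge to those of the sign function. -/
theorem tendsto_fourierCoeff_approxSign (k : ℤ) :
    Tendsto (fun N => fourierCoeff (compSin (approxSign N) (continuous_approxSign N)) k) atTop
      (𝓝 ((1 / 2 : ℂ) * ∫ t in (-1 : ℝ)..1,
        signFun t * Complex.exp (-(Complex.I * Real.pi * k * t)))) := by
  simp only [fourierCoeff_eq_integral]
  refine Tendsto.const_mul _ ?_
  refine intervalIntegral.tendsto_integral_filter_of_dominated_convergence (fun _ => 1)
    (Eventually.of_forall fun N => ?_) (Eventually.of_forall fun N => ?_)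
    intervalIntegrable_const ?_
  · refine Continuous.aestronglyMeasurable ?_
    have : Continuous fun t : ℝ => compSin (approxSign N) (continuous_approxSign N)
        (t : AddCircle (2 : ℝ)) :=
      (ContinuousMap.continuous _).comp (AddCircle.continuous_mk' 2)
    fun_prop
  · refine ae_of_all _ fun t _ => ?_
    rw [norm_mul, compSin_coe, Complex.norm_real]
    have h : ‖Complex.exp (-(Complex.I * Real.pi * k * t))‖ = 1 := by
      rw [show -(Complex.I * Real.pi * k * t) = ((-(Real.pi * k * t) : ℝ) : ℂ) * Complex.I by
        push_cast; ring]
      exact Complex.norm_exp_ofReal_mul_I _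
    rw [h, mul_one]
    exact abs_approxSign_le N _
  · have h1 : ∀ᵐ t : ℝ, t ≠ 1 := by simp [ae_iff]
    filter_upwards [h1] with t ht1 ht
    rw [Set.uIoc_of_le (by norm_num)] at ht
    refine Tendsto.mul_const _ ?_
    simp only [compSin_coe]
    rw [signFun, ← sign_sin_pi_mul ht.1 (lt_of_le_of_ne ht.2 ht1)]
    exact (Complex.continuous_ofReal.tendsto _).comp (tendsto_approxSign _)

theorem integral_signFun_neg (k : ℤ) :
    ∫ t in (-1 : ℝ)..1, signFun t * Complex.exp (-(Complex.I * Real.pi * ((-k : ℤ) : ℂ) * t)) =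
      -∫ t in (-1 : ℝ)..1, signFun t * Complex.exp (-(Complex.I * Real.pi * k * t)) := by
  rw [← intervalIntegral.integral_neg]
  have h := intervalIntegral.integral_comp_neg (a := -1) (b := 1)
    (fun t : ℝ => signFun t * Complex.exp (-(Complex.I * Real.pi * ((-k : ℤ) : ℂ) * t)))
  rw [neg_neg] at h
  rw [← h]
  refine intervalIntegral.integral_congr fun t _ => ?_
  simp only [signFun, abs_neg, div_neg, Complex.ofReal_neg, neg_mul]
  congr 3
  push_cast
  ring

end SignFunction

/-! ### The operator `|t| / t`: existence, uniqueness, zero expectation. -/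

section SignUnitary

open Filter Topology

variable {n : ℕ}

theorem circleHom_fourier (i : Fin n) (k : ℤ) :
    circleHom (genUnitary_mem_unitary i) (fourier k) = leftReg (FreeGroup.of i ^ k) := by
  have hpow : ∀ m : ℕ, circleHom (genUnitary_mem_unitary i) (fourier (m : ℤ)) =
      leftReg (FreeGroup.of i ^ m) := by
    intro m
    have : (fourier (m : ℤ) : C(AddCircle (2 : ℝ), ℂ)) = fourier 1 ^ m := by
      ext t
      simp [fourier_apply, AddCircle.toCircle_nsmul]
    rw [this, map_pow, circleHom_fourier_one, ← leftReg_pow]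
    rfl
  obtain ⟨m, rfl | rfl⟩ := k.eq_nat_or_neg
  · rw [hpow, zpow_natCast]
  · have : (fourier (-(m : ℤ)) : C(AddCircle (2 : ℝ), ℂ)) = star (fourier (m : ℤ)) := by
      ext t
      simp only [fourier_neg, ContinuousMap.star_apply, RCLike.star_def]
    rw [this, map_star, hpow, star_leftReg, zpow_neg, zpow_natCast]

/-- A closed linear condition on functions on the circle may be tested on characters. -/
theorem circle_induction {V : Submodule ℂ C(AddCircle (2 : ℝ), ℂ)}
    (hV : IsClosed (V : Set C(AddCircle (2 : ℝ), ℂ))) (h : ∀ k, fourier k ∈ V)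
    (f : C(AddCircle (2 : ℝ), ℂ)) : f ∈ V := by
  have hle : (Submodule.span ℂ (Set.range (fourier (T := (2 : ℝ))))).topologicalClosure ≤ V :=
    Submodule.topologicalClosure_minimal _ (Submodule.span_le.2 (Set.range_subset_iff.2 h)) hV
  rw [span_fourier_closure_eq_top] at hle
  exact hle trivial

theorem circleHom_mem_genAlg (i : Fin n) (f : C(AddCircle (2 : ℝ), ℂ)) :
    circleHom (genUnitary_mem_unitary i) f ∈ genAlg i := by
  have hcl : IsClosed (genAlg i :
      Set (ellTwo (FreeGroup (Fin n)) →L[ℂ] ellTwo (FreeGroup (Fin n)))) := by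
    rw [← VonNeumannAlgebra.centralizer_centralizer]
    exact Set.isClosed_centralizer _
  refine circle_induction (V := (genAlg i).toStarSubalgebra.toSubalgebra.toSubmodule.comap
    (circleHom (genUnitary_mem_unitary i)).toAlgHom.toLinearMap)
    (hcl.preimage (continuous_circleHom (genUnitary_mem_unitary i))) (fun k => ?_) f
  change circleHom (genUnitary_mem_unitary i) (fourier k) ∈ genAlg i
  rw [circleHom_fourier]
  exact leftReg_zpow_mem_genAlg i k

theorem canonicalTrace_circleHom (i : Fin n) (f : C(AddCircle (2 : ℝ), ℂ)) (k : ℤ) :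
    canonicalTrace (FreeGroup (Fin n))
      (circleHom (genUnitary_mem_unitary i) f * leftReg (FreeGroup.of i ^ (-k))) =
      fourierCoeff f k := by
  classical
  let L : C(AddCircle (2 : ℝ), ℂ) →ₗ[ℂ] ℂ := canonicalTrace (FreeGroup (Fin n)) ∘ₗ
    LinearMap.mulRight ℂ (leftReg (FreeGroup.of i ^ (-k))) ∘ₗ
    (circleHom (genUnitary_mem_unitary i)).toAlgHom.toLinearMap
  -- Factoring the Fourier coefficient through L² makes it a continuous functional, so the identity
  -- need only be checked on characters.
  let R : C(AddCircle (2 : ℝ), ℂ) →L[ℂ] ℂ :=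
    (lp.evalCLM ℂ (fun _ : ℤ => ℂ) 2 k) ∘L
      (fourierBasis (T := (2 : ℝ))).repr.toContinuousLinearEquiv.toContinuousLinearMap ∘L
      (ContinuousMap.toLp (E := ℂ) 2 AddCircle.haarAddCircle ℂ)
  have hR : ∀ f, R f = fourierCoeff f k := fun f => by
    rw [← fourierCoeff_toLp, ← fourierBasis_repr]
    rfl
  have hL : Continuous L := by
    have h1 := (continuous_circleHom (genUnitary_mem_unitary i)).mul
      (continuous_const (y := leftReg (FreeGroup.of i ^ (-k))))
    exact continuous_const.inner (h1.clm_apply continuous_const)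
  rw [← hR]
  refine circle_induction (V := LinearMap.eqLocus L R.toLinearMap)
    (isClosed_eq hL R.continuous) (fun m => ?_) f
  change canonicalTrace (FreeGroup (Fin n))
    (circleHom (genUnitary_mem_unitary i) (fourier m) * leftReg (FreeGroup.of i ^ (-k))) =
      R (fourier m)
  rw [hR, fourierCoeff_fourier, circleHom_fourier, ← leftReg_mul, ← zpow_add,
    canonicalTrace_leftReg, Pi.single_apply]
  refine if_congr ⟨fun h => ?_, fun h => ?_⟩ rfl rfl
  · have := freeGroup_of_zpow_eq_one h
    omega
  · rw [h, add_neg_cancel, zpow_zero]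

/-- `w_i - w_i*` is injective. -/
theorem eq_zero_of_genUnitary_sub_star_apply (i : Fin n) {ξ : ellTwo (FreeGroup (Fin n))}
    (h : (genUnitary i - star (genUnitary i)) ξ = 0) : ξ = 0 := by
  refine eq_zero_of_leftReg_apply_eq (g := FreeGroup.of i ^ 2) (fun m hm h1 => ?_) ?_
  · rw [← pow_mul, ← zpow_natCast] at h1
    have := freeGroup_of_zpow_eq_one h1
    simp at this
    exact hm this
  · rw [_root_.sub_apply, sub_eq_zero] at h
    rw [← leftReg_pow, pow_two]
    change genUnitary i (genUnitary i ξ) = ξ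
    rw [h]
    change (genUnitary i * star (genUnitary i)) ξ = ξ
    rw [Unitary.mul_star_self_of_mem (genUnitary_mem_unitary i)]
    rfl

/-- sin πt corresponds to (w − w*)/2i, and (w − w*)ξ = 0 would make `ξ` a fixed vector of w². -/
theorem eq_zero_of_circleHom_sin_mul (i : Fin n)
    {y : ellTwo (FreeGroup (Fin n)) →L[ℂ] ellTwo (FreeGroup (Fin n))}
    (h : circleHom (genUnitary_mem_unitary i) (compSin (fun x => x) continuous_id) * y = 0) :
    y = 0 := by
  have hw : genUnitary i - star (genUnitary i) = (2 * Complex.I) •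
      circleHom (genUnitary_mem_unitary i) (compSin (fun x => x) continuous_id) := by
    rw [← map_smul, ← fourier_sub_star, map_sub, map_star, circleHom_fourier_one]
  ext1 ξ
  refine eq_zero_of_genUnitary_sub_star_apply i ?_
  rw [hw, _root_.smul_apply]
  have := congrArg (fun T : ellTwo (FreeGroup (Fin n)) →L[ℂ] ellTwo (FreeGroup (Fin n)) => T ξ) h
  change circleHom (genUnitary_mem_unitary i) (compSin (fun x => x) continuous_id) (y ξ) = 0
    at this
  rw [this, smul_zero]

/-- The operator corresponding to `|t| / t`. -/
theorem exists_correspondsTo_signFun (i : Fin n) :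
    ∃ u : ellTwo (FreeGroup (Fin n)) →L[ℂ] ellTwo (FreeGroup (Fin n)),
      CorrespondsTo i u signFun ∧ star u = u ∧ u * u = 1 := by
  set Φ := circleHom (genUnitary_mem_unitary i)
  set f : ℕ → C(AddCircle (2 : ℝ), ℂ) := fun N => compSin (approxSign N) (continuous_approxSign N)
  set a := compSin (fun x => |x|) continuous_abs
  set s := compSin (fun x => x) continuous_id
  have hbound : ∀ N, ‖Φ (f N)‖ ≤ 1 := fun N =>
    (norm_circleHom_le _ _).trans (norm_compSin_approxSign_le N)
  obtain ⟨T, hT⟩ := exists_weakLimit hbound (hyperfilter ℕ)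
  have hmem : T ∈ genAlg i := mem_of_weakLimit (fun N => circleHom_mem_genAlg i (f N)) hT
  have hstar : star T = T := isSelfAdjoint_of_weakLimit (fun N => by
    rw [← map_star, star_compSin]) hT
  -- Here the weak limit passes through a product because one factor is fixed, while `Φ (f N * a)`
  -- converges in norm.
  have hTa : T * Φ a = Φ s := by
    refine ext_of_inner fun ξ η => tendsto_nhds_unique (hT ξ (Φ a η)) ?_
    have h1 : Tendsto (fun N => Φ (f N * a)) atTop (𝓝 (Φ s)) :=
      ((continuous_circleHom _).tendsto _).comp tendsto_compSin_mul
    have h2 : Tendsto (fun N => inner ℂ ξ (Φ (f N * a) η)) atTop (𝓝 (inner ℂ ξ (Φ s η))) :=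
      tendsto_const_nhds.inner
        (((ContinuousLinearMap.apply ℂ (ellTwo (FreeGroup (Fin n))) η).continuous.tendsto _).comp h1)
    refine (h2.mono_left Nat.hyperfilter_le_atTop).congr fun N => ?_
    rw [map_mul]
    rfl
  have hcomm : ∀ g, T * Φ g = Φ g * T := fun g =>
    genAlg_isAbelian i T hmem _ (circleHom_mem_genAlg i g)
  refine ⟨T, ⟨hmem, fun k => ?_⟩, hstar, ?_⟩
  · refine tendsto_nhds_unique (f := fun N => canonicalTrace (FreeGroup (Fin n))
      (Φ (f N) * leftReg (FreeGroup.of i ^ (-k)))) (l := hyperfilter ℕ) (hT _ _) ?_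
    simp only [Φ, canonicalTrace_circleHom]
    exact (tendsto_fourierCoeff_approxSign k).mono_left Nat.hyperfilter_le_atTop
  · rw [← sub_eq_zero]
    refine eq_zero_of_circleHom_sin_mul i (eq_zero_of_circleHom_sin_mul i ?_)
    change Φ s * (Φ s * (T * T - 1)) = 0
    have haa : Φ a * Φ a = Φ s * Φ s := by
      rw [← map_mul, ← map_mul]
      exact congrArg Φ compSin_abs_mul_self
    -- From |s|² = s² and |s|T = s it follows that s²T² = (|s|T)² = s²; injectivity of s then
    -- cancels s².
    have h3 : Φ s * Φ s * (T * T) = Φ s * Φ s := by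
      have e : Φ a * T = Φ s := by rw [← hcomm a, hTa]
      calc Φ s * Φ s * (T * T) = Φ a * (Φ a * T) * T := by
            rw [← haa]; simp only [mul_assoc]
        _ = Φ a * T * Φ s := by rw [e, mul_assoc, ← hcomm s, ← mul_assoc, e]
        _ = Φ s * Φ s := by rw [e]
    rw [mul_sub, mul_sub, mul_one, ← mul_assoc, h3, sub_self]

/-- Elements of `A_i` are determined by their Fourier coefficients. -/
theorem eq_zero_of_trace_mul_zpow (i : Fin n)
    {x : ellTwo (FreeGroup (Fin n)) →L[ℂ] ellTwo (FreeGroup (Fin n))} (hx : x ∈ genAlg i)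
    (h : ∀ k : ℤ, canonicalTrace (FreeGroup (Fin n)) (x * leftReg (FreeGroup.of i ^ (-k))) = 0) :
    x = 0 := by
  refine eq_zero_of_canonicalTrace_mul_star (genAlg_le i hx) ?_
  have hf := (canonicalTrace_normalOn (groupVNA (FreeGroup (Fin n)) :
    Set (ellTwo (FreeGroup (Fin n)) →L[ℂ] ellTwo (FreeGroup (Fin n))))).comp_mul
    (genAlg_le i hx) (one_mem _)
  -- The normal functional y ↦ τ(xy) kills all powers of w_i, hence all of A_i, in particular x*.
  have := normalDense_genPowers i _ hf ?_ (star x) (star_mem hx)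
  · simpa using this
  · rintro y (rfl | ⟨k, -, rfl⟩)
    · simpa [leftReg_one] using h 0
    · simpa using h (-k)

theorem CorrespondsTo.unique {i : Fin n} {f : ℝ → ℂ}
    {x y : ellTwo (FreeGroup (Fin n)) →L[ℂ] ellTwo (FreeGroup (Fin n))}
    (hx : CorrespondsTo i x f) (hy : CorrespondsTo i y f) : x = y := by
  rw [← sub_eq_zero]
  refine eq_zero_of_trace_mul_zpow i (sub_mem hx.1 hy.1) fun k => ?_
  rw [sub_mul, map_sub, hx.2, hy.2, sub_self]

/-- Elements with odd Fourier coefficients have zero expectation on `B_i`. -/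
theorem isCondExp_zero_of_odd (i : Fin n)
    {u : ellTwo (FreeGroup (Fin n)) →L[ℂ] ellTwo (FreeGroup (Fin n))} (hu : u ∈ genAlg i)
    (hodd : ∀ k : ℤ, canonicalTrace (FreeGroup (Fin n)) (u * leftReg (FreeGroup.of i ^ (-k))) =
      -canonicalTrace (FreeGroup (Fin n)) (u * leftReg (FreeGroup.of i ^ k))) :
    IsCondExp (canonicalTrace (FreeGroup (Fin n))) (evenAlg i) u 0 := by
  refine ⟨zero_mem _, fun b hb => ?_⟩
  rw [zero_mul, map_zero, eq_comm]
  set h := genUnitary i + star (genUnitary i) with hh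
  have hh' : h = leftReg (FreeGroup.of i ^ (1 : ℤ)) + leftReg (FreeGroup.of i ^ (-1 : ℤ)) := by
    rw [hh, zpow_one, zpow_neg_one, ← star_leftReg]
    rfl
  have hhM : h ∈ groupVNA (FreeGroup (Fin n)) := add_mem (leftReg_mem_groupVNA _)
    (star_mem (leftReg_mem_groupVNA _))
  have hself : star h = h := by rw [hh, star_add, star_star, add_comm]
  -- Multiplication by w + w* preserves oddness of Fourier coefficients, and an odd sequence
  -- vanishes at 0; thus τ(uh^m) = 0 for all m.
  have hpow : ∀ (m : ℕ) (k : ℤ),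
      canonicalTrace (FreeGroup (Fin n)) (u * (h ^ m * leftReg (FreeGroup.of i ^ (-k)))) =
        -canonicalTrace (FreeGroup (Fin n)) (u * (h ^ m * leftReg (FreeGroup.of i ^ k))) := by
    intro m
    induction m with
    | zero => simpa using hodd
    | succ m ih =>
      intro k
      have h1 : ∀ k : ℤ, h ^ (m + 1) * leftReg (FreeGroup.of i ^ k) =
          h ^ m * leftReg (FreeGroup.of i ^ (1 + k)) +
            h ^ m * leftReg (FreeGroup.of i ^ (-1 + k)) := by
        intro k
        rw [pow_succ, mul_assoc, ← mul_add, zpow_add, zpow_add, leftReg_mul, leftReg_mul,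
          ← add_mul, ← hh']
      rw [h1, h1, mul_add, mul_add, map_add, map_add, show (1 + -k : ℤ) = -(-1 + k) by ring,
        show (-1 + -k : ℤ) = -(1 + k) by ring, ih, ih]
      ring
  have hd := normalDense_vnGen (S := Set.range fun m : ℕ => h ^ m)
    (M := groupVNA (FreeGroup (Fin n))) (by rintro _ ⟨m, rfl⟩; exact pow_mem hhM m)
    ⟨0, pow_zero h⟩ (by rintro _ ⟨m, rfl⟩ _ ⟨m', rfl⟩; exact ⟨m + m', pow_add h m m'⟩)
    (by rintro _ ⟨m, rfl⟩; exact ⟨m, by simp only [star_pow, hself]⟩)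
  have hle : evenAlg i ≤ vnGen (Set.range fun m : ℕ => h ^ m) :=
    vnGen_le (Set.singleton_subset_iff.2 (subset_vnGen _ ⟨1, pow_one h⟩))
  have hf := (canonicalTrace_normalOn (groupVNA (FreeGroup (Fin n)) :
    Set (ellTwo (FreeGroup (Fin n)) →L[ℂ] ellTwo (FreeGroup (Fin n))))).comp_mul
    (genAlg_le i hu) (one_mem _)
  have := hd _ hf ?_ b (hle hb)
  · simpa using this
  · rintro _ ⟨m, rfl⟩
    have h0 := hpow m 0
    rw [neg_zero, zpow_zero, leftReg_one, mul_one, self_eq_neg] at h0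
    simpa using h0

theorem CorrespondsTo.isCondExp_zero {i : Fin n}
    {u : ellTwo (FreeGroup (Fin n)) →L[ℂ] ellTwo (FreeGroup (Fin n))}
    (hu : CorrespondsTo i u signFun) :
    IsCondExp (canonicalTrace (FreeGroup (Fin n))) (evenAlg i) u 0 := by
  refine isCondExp_zero_of_odd i hu.1 fun k => ?_
  have h := hu.2 (-k)
  rw [neg_neg, integral_signFun_neg, mul_neg] at h
  rw [h, hu.2 k, neg_neg]

theorem CorrespondsTo.mul_self {i : Fin n}
    {u : ellTwo (FreeGroup (Fin n)) →L[ℂ] ellTwo (FreeGroup (Fin n))}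
    (hu : CorrespondsTo i u signFun) : u ∈ unitary (_ →L[ℂ] _) ∧ u * u = 1 := by
  obtain ⟨T, hT, hstar, hsq⟩ := exists_correspondsTo_signFun i
  obtain rfl := hu.unique hT
  refine ⟨?_, hsq⟩
  rw [Unitary.mem_iff, hstar]
  exact ⟨hsq, hsq⟩

end SignUnitary

/-! ### Assembly of the two statements. -/

theorem theoremB :
    -- the radial subalgebra of the free group factor `L(F_n)`, `2 ≤ n < ∞`
    (∀ n : ℕ, 2 ≤ n →
      -- the unitaries `u_i = |t|/t` in `A_i` exist, have period two and zero expectation on `B_i`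
      (∀ i : Fin n, ∃! u, CorrespondsTo i u signFun) ∧
      (∀ (i : Fin n) (u : ellTwo (FreeGroup (Fin n)) →L[ℂ] ellTwo (FreeGroup (Fin n))),
        CorrespondsTo i u signFun →
          u ∈ unitary (ellTwo (FreeGroup (Fin n)) →L[ℂ] ellTwo (FreeGroup (Fin n))) ∧
          u * u = 1 ∧
          IsCondExp (canonicalTrace (FreeGroup (Fin n))) (evenAlg i) u 0) ∧
      -- their products `u_i u_j` are Haar unitaries freely independent of `A_r`
      (∀ i j : Fin n, i ≠ j →
        ∀ u v : ellTwo (FreeGroup (Fin n)) →L[ℂ] ellTwo (FreeGroup (Fin n)),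
          CorrespondsTo i u signFun → CorrespondsTo j v signFun →
          IsHaarUnitary (groupVNA (FreeGroup (Fin n))) (canonicalTrace (FreeGroup (Fin n)))
            (u * v) ∧
          ElementFreeFrom (canonicalTrace (FreeGroup (Fin n))) (u * v) (radialAlg n)) ∧
      -- the same for any other unitaries of `A_i`, `A_j` with zero expectation on `B_i`, `B_j`
      (∀ i j : Fin n, i ≠ j →
        ∀ u v : ellTwo (FreeGroup (Fin n)) →L[ℂ] ellTwo (FreeGroup (Fin n)),
          u ∈ genAlg i → v ∈ genAlg j →
          u ∈ unitary (ellTwo (FreeGroup (Fin n)) →L[ℂ] ellTwo (FreeGroup (Fin n))) →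
          v ∈ unitary (ellTwo (FreeGroup (Fin n)) →L[ℂ] ellTwo (FreeGroup (Fin n))) →
          IsCondExp (canonicalTrace (FreeGroup (Fin n))) (evenAlg i) u 0 →
          IsCondExp (canonicalTrace (FreeGroup (Fin n))) (evenAlg j) v 0 →
          IsHaarUnitary (groupVNA (FreeGroup (Fin n))) (canonicalTrace (FreeGroup (Fin n)))
            (u * v) ∧
          ElementFreeFrom (canonicalTrace (FreeGroup (Fin n))) (u * v) (radialAlg n)) ∧
      -- hence the weak FC property
      WeakFC (groupVNA (FreeGroup (Fin n))) (canonicalTrace (FreeGroup (Fin n)))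
        (radialAlg n)) ∧
    -- the general lemma on free products of two abelian tracial von Neumann algebras
    (∀ (H : Type*) [NormedAddCommGroup H] [InnerProductSpace ℂ H] [CompleteSpace H]
      (M A₁ A₂ B₁ B₂ : VonNeumannAlgebra H) (τ : (H →L[ℂ] H) →ₗ[ℂ] ℂ) (u₁ u₂ : H →L[ℂ] H),
      IsFreeProduct M τ A₁ A₂ → IsAbelianVNA A₁ → IsAbelianVNA A₂ →
      B₁ ≤ A₁ → B₂ ≤ A₂ →
      u₁ ∈ A₁ → u₂ ∈ A₂ → u₁ ∈ unitary (H →L[ℂ] H) → u₂ ∈ unitary (H →L[ℂ] H) →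
      IsCondExp τ B₁ u₁ 0 → IsCondExp τ B₂ u₂ 0 →
      ElementFreeFrom τ (u₁ * u₂)
        (vnGen ((B₁ : Set (H →L[ℂ] H)) ∪ (B₂ : Set (H →L[ℂ] H))))) := by
  refine ⟨fun n hn => ?_, ?_⟩
  · have hsign : ∀ i j : Fin n, i ≠ j →
        ∀ u v : ellTwo (FreeGroup (Fin n)) →L[ℂ] ellTwo (FreeGroup (Fin n)),
          CorrespondsTo i u signFun → CorrespondsTo j v signFun →
          IsHaarUnitary (groupVNA (FreeGroup (Fin n))) (canonicalTrace (FreeGroup (Fin n)))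
            (u * v) ∧
          ElementFreeFrom (canonicalTrace (FreeGroup (Fin n))) (u * v) (radialAlg n) :=
      fun i j hij u v hu hv => isHaarUnitary_and_elementFreeFrom hij hu.1 hv.1 hu.mul_self.1
        hv.mul_self.1 hu.isCondExp_zero hv.isCondExp_zero
    refine ⟨fun i => ?_, fun i u hu => ⟨hu.mul_self.1, hu.mul_self.2, hu.isCondExp_zero⟩, hsign,
      fun i j hij u v => isHaarUnitary_and_elementFreeFrom hij, ?_, ?_⟩
    · obtain ⟨T, hT, -⟩ := exists_correspondsTo_signFun i
      exact ⟨T, hT, fun y hy => hy.unique hT⟩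
    · exact vnGen_le (Set.singleton_subset_iff.2 (sum_mem fun i _ =>
        add_mem (leftReg_mem_groupVNA _) (star_mem (leftReg_mem_groupVNA _))))
    · obtain ⟨u, hu, -⟩ := exists_correspondsTo_signFun (⟨0, by omega⟩ : Fin n)
      obtain ⟨v, hv, -⟩ := exists_correspondsTo_signFun (⟨1, by omega⟩ : Fin n)
      exact ⟨u * v, hsign _ _ (by simp) u v hu hv⟩
  · intro H _ _ _ M A₁ A₂ B₁ B₂ τ u₁ u₂ h hA₁ hA₂ hB₁ hB₂ hu₁ hu₂ hu₁' hu₂' hE₁ hE₂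
    exact h.elementFreeFrom hA₁ hA₂ hB₁ hB₂ hu₁ hu₂ hu₁' hu₂' hE₁ hE₂
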